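/- Let $X$ be a nonempty compact metric space of finite covering dimension $d$ and let $T$ be a homeomorphism of $X$. Let $\alpha_T$ be the automorphism $f\mapsto f\circ T$ of the $\mathrm{C}^*$-algebra $A=C(X)$ of continuous complex functions on $X$. Then $$h_{\mathrm{top}}(T)=\mathrm{ht}(\alpha_T)=\mathrm{ht}_{\mathrm{nuc}}(\alpha_T)=\mathrm{ht}_{\mathrm{dr}}(\alpha_T)=h_{\mathrm{top},c}(T)$$ in $[0,\infty]$, and the limits in the definitions of $h_{\mathrm{top}}$ and $h_{\mathrm{top},c}$ below exist for every finite open cover. The five quantities are defined as follows. **Topological entropies.** The covering dimension is the least $d$ such that every finite open cover has a finite open refinement in which each point lies in at most $d+1$ members. For a finite open cover $\mathcal U$ of $X$ let $\mathcal U_0^{n-1}=\bigvee_{j=0}^{n-1}T^{-j}(\mathcal U)$ be the cover by the nonempty sets $\bigcap_{j=0}^{n-1}T^{-j}(U_j)$ with $U_j\in\mathcal U$. Let $N(\mathcal U_0^{n-1})$ be the minimal cardinality of a subcover of it, and let $N_c(\mathcal U_0^{n-1})$ be the minimal cardinality of an open cover $\mathcal V$ such that each $V\in\mathcal V$ is contained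 in a member of $\mathcal U_0^{n-1}$ and $\mathcal V$ is a union of $d+1$ subcollections, each consisting of pairwise disjoint sets. Then $$h_{\mathrm{top}}(T)=\sup_{\mathcal U}\lim_{n\to\infty}\tfrac1n\log N(\mathcal U_0^{n-1}),\qquad h_{\mathrm{top},c}(T)=\sup_{\mathcal U}\lim_{n\to\infty}\tfrac1n\log N_c(\mathcal U_0^{n-1}),$$ where $\mathcal U$ ranges over the finite open covers of $X$. **Noncommutative entropies.** The rank of a finite-dimensional $\mathrm{C}^*$-algebra $F$ is the dimension of a maximal abelian $^*$-subalgebra of $F$; "cpc" means completely positive and contractive; a cp map $\phi$ has order zero if $\phi(a)\phi(b)=0$ whenever $a,b\ge0$ and $ab=0$. Let $\mathcal F\subseteq A$ be finite and $\varepsilon>0$. An $(\mathcal F,\varepsilon)$-completely positive system consists of a finite-dimensional $\mathrm{C}^*$-algebra $F$ and cpc maps $\psi\colon A\to F$, $\varphi\colon F\to A$ with $\|\varphi(\psi(a))-a\|\le\varepsilon$ for all $a\in\mathcal F$. For an integer $m\ge0$, an $(m,\mathcal F,\varepsilon)$-decomposable system consists of a finite-dimensional $\mathrm{C}^*$-algebra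 $F=F^{(0)}\oplus\dots\oplus F^{(m)}$, a cpc map $\psi\colon A\to F$ and a linear map $\varphi\colon F\to A$ each of whose restrictions $\varphi|_{F^{(i)}}$ is cpc of order zero, with $\|\varphi(\psi(a))-a\|\le\varepsilon$ for all $a\in\mathcal F$; it is contractive if $\varphi$ is contractive. The nuclear dimension $\dim_{\mathrm{nuc}}(A)$ (respectively, the decomposition rank $\mathrm{dr}(A)$) is the least $m$ such that $(m,\mathcal F,\varepsilon)$-decomposable systems (respectively, contractive ones) exist for all finite $\mathcal F\subseteq A$ and all $\varepsilon>0$, and it is $\infty$ if there is no such $m$. Let $\mathrm{rcp}(\mathcal F,\varepsilon)$, $r_{\mathrm{nuc}}(\mathcal F,\varepsilon)$ and $r_{\mathrm{dr}}(\mathcal F,\varepsilon)$ be the infimum of $\mathrm{rank}(F)$ over, respectively, all $(\mathcal F,\varepsilon)$-completely positive systems, all $(\dim_{\mathrm{nuc}}(A),\mathcal F,\varepsilon)$-decomposable systems and all contractive $(\mathrm{dr}(A),\mathcal F,\varepsilon)$-decomposable systems. For an endomorphism $\alpha$ of $A$, $$\mathrm{ht}(\alpha)=\sup_{\mathcal F}\sup_{\varepsilon>0}\limsup_{n\to\infty}\tfrac1n\log\mathrm{rcp}\bigl(\mathcal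 F\cup\alpha(\mathcal F)\cup\dots\cup\alpha^{n-1}(\mathcal F),\varepsilon\bigr),$$ where $\mathcal F$ ranges over the finite subsets of $A$, and $\mathrm{ht}_{\mathrm{nuc}}(\alpha)$, $\mathrm{ht}_{\mathrm{dr}}(\alpha)$ are defined in the same way from $r_{\mathrm{nuc}}$, $r_{\mathrm{dr}}$; by convention $\mathrm{ht}_{\mathrm{nuc}}(\alpha)=\infty$ if $\dim_{\mathrm{nuc}}(A)=\infty$, and $\mathrm{ht}_{\mathrm{dr}}(\alpha)=\infty$ if $\mathrm{dr}(A)=\infty$. -/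

import Mathlib

open Set Filter Topology
open scoped ENNReal ComplexOrder CStarAlgebra

namespace ColouredEntropy

noncomputable section

/-! ### Open covers and topological entropies -/

section Covers

variable {X : Type*} [TopologicalSpace X]

/-- `𝒰` is an open cover of the space `X`. -/
def IsOpenCover (𝒰 : Set (Set X)) : Prop :=
  (∀ U ∈ 𝒰, IsOpen U) ∧ ⋃₀ 𝒰 = univ

/-- `𝒱` is a refinement of `𝒰`: an open cover each member of which lies in some member of `𝒰`. -/
def IsRefinement (𝒱 𝒰 : Set (Set X)) : Prop :=
  IsOpenCover 𝒱 ∧ ∀ V ∈ 𝒱, ∃ U ∈ 𝒰, V ⊆ U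

/-- `𝒱` is the union of `n` subcollections, each consisting of pairwise disjoint sets. -/
def IsColoured (n : ℕ) (𝒱 : Set (Set X)) : Prop :=
  ∃ c : Fin n → Set (Set X), (∀ i, (c i).PairwiseDisjoint id) ∧ 𝒱 = ⋃ i, c i

variable (X) in
/-- The covering dimension of `X` is at most `d`: every finite open cover has a finite
refinement such that each point lies in at most `d + 1` of its members. -/
def CoveringDimLE (d : ℕ) : Prop :=
  ∀ 𝒰 : Set (Set X), 𝒰.Finite → IsOpenCover 𝒰 →
    ∃ 𝒱 : Set (Set X), 𝒱.Finite ∧ IsRefinement 𝒱 𝒰 ∧ ∀ x : X, {V ∈ 𝒱 | x ∈ V}.encard ≤ d + 1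

variable (X) in
/-- The covering dimension of a nonempty space, `⊤` if it is infinite. -/
def coveringDim : ℕ∞ := sInf {k | ∃ d : ℕ, CoveringDimLE X d ∧ k = d}

/-- The cover `𝒰 ∨ T⁻¹𝒰 ∨ ⋯ ∨ T⁻⁽ⁿ⁻¹⁾𝒰`, the least common refinement, consisting of the nonempty
intersections of members of the preimages of `𝒰` under `T⁰, …, Tⁿ⁻¹`. -/
def dynCover (T : X ≃ₜ X) (𝒰 : Set (Set X)) (n : ℕ) : Set (Set X) :=
  {W | W.Nonempty ∧ ∃ U : Fin n → Set X, (∀ j, U j ∈ 𝒰) ∧ W = ⋂ j : Fin n, (T^[j]) ⁻¹' (U j)}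

/-- The minimal cardinality of a subcover of `𝒰`. -/
def minSubcover (𝒰 : Set (Set X)) : ℕ∞ :=
  sInf {k | ∃ 𝒱 ⊆ 𝒰, ⋃₀ 𝒱 = univ ∧ k = 𝒱.encard}

/-- The minimal cardinality of a `(d + 1)`-coloured refinement of `𝒰`, with `d` the covering
dimension of the space (assumed finite). -/
def minColouredRefinement (𝒰 : Set (Set X)) : ℕ∞ :=
  sInf {k | ∃ 𝒱, IsRefinement 𝒱 𝒰 ∧ IsColoured ((coveringDim X).toNat + 1) 𝒱 ∧ k = 𝒱.encard}

end Covers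

/-- The exponential growth rate `limsup (1/n) log u(n)`. -/
def growth (u : ℕ → ℕ∞) : EReal :=
  limsup (fun n : ℕ ↦ ENNReal.log (u n : ℝ≥0∞) / (n : EReal)) atTop

/-- The exponential growth rate of `u` exists as a limit, that is, `(1/n) log u(n)` converges (in
the extended reals), necessarily to `growth u`. -/
def HasGrowthLimit (u : ℕ → ℕ∞) : Prop :=
  Tendsto (fun n : ℕ ↦ ENNReal.log (u n : ℝ≥0∞) / (n : EReal)) atTop (𝓝 (growth u))

/-- Topological entropy, through minimal subcovers of iterated finite open covers. -/
def topEntropy {X : Type*} [TopologicalSpace X] (T : X ≃ₜ X) : EReal :=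
  ⨆ (𝒰 : Set (Set X)) (_ : 𝒰.Finite) (_ : IsOpenCover 𝒰),
    growth fun n ↦ minSubcover (dynCover T 𝒰 n)

/-- Coloured topological entropy of a homeomorphism of a finite-dimensional space. -/
def colouredTopEntropy {X : Type*} [TopologicalSpace X] (T : X ≃ₜ X) : EReal :=
  ⨆ (𝒰 : Set (Set X)) (_ : 𝒰.Finite) (_ : IsOpenCover 𝒰),
    growth fun n ↦ minColouredRefinement (dynCover T 𝒰 n)

/-! ### Finite-dimensional C⋆-algebras -/

/-- A finite-dimensional C⋆-algebra (such an algebra is automatically unital), possibly zero.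
The partial order is determined by the C⋆-algebra. -/
structure FinDimCStarAlgebra where
  carrier : Type
  [cstar : CStarAlgebra carrier]
  [order : PartialOrder carrier]
  [starOrdered : StarOrderedRing carrier]
  [finiteDimensional : FiniteDimensional ℂ carrier]

attribute [instance] FinDimCStarAlgebra.cstar FinDimCStarAlgebra.order
  FinDimCStarAlgebra.starOrdered FinDimCStarAlgebra.finiteDimensional

instance : CoeSort FinDimCStarAlgebra Type := ⟨FinDimCStarAlgebra.carrier⟩

/-- The direct sum of finitely many finite-dimensional C⋆-algebras. -/
def FinDimCStarAlgebra.directSum {k : ℕ} (F : Fin k → FinDimCStarAlgebra) :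
    FinDimCStarAlgebra where
  carrier := ∀ i, F i

/-- `B` is a maximal abelian ⋆-subalgebra of `F`. -/
def IsMaximalAbelian {F : Type*} [CStarAlgebra F] (B : StarSubalgebra ℂ F) : Prop :=
  Maximal (fun C : StarSubalgebra ℂ F ↦ ∀ x ∈ C, ∀ y ∈ C, x * y = y * x) B

/-- The rank of a finite-dimensional C⋆-algebra: the dimension of a maximal abelian
⋆-subalgebra (all of these have the same dimension). -/
def FinDimCStarAlgebra.rank (F : FinDimCStarAlgebra) : ℕ :=
  sInf {k | ∃ B : StarSubalgebra ℂ F, IsMaximalAbelian B ∧ k = Module.finrank ℂ B}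

/-! ### Completely positive approximations -/

section Approximation

variable {A : Type*} [NonUnitalCStarAlgebra A] [PartialOrder A] [StarOrderedRing A]

/-- The map `f` is contractive. -/
def IsContractive {B C : Type*} [Norm B] [Norm C] (f : B → C) : Prop := ∀ x, ‖f x‖ ≤ ‖x‖

/-- A completely positive map has order zero if it sends positive elements with product zero
to elements with product zero. -/
def IsOrderZero {B C : Type*} [NonUnitalCStarAlgebra B] [PartialOrder B] [StarOrderedRing B]
    [NonUnitalCStarAlgebra C] [PartialOrder C] [StarOrderedRing C] (φ : B →CP C) : Prop :=
  ∀ a b : B, 0 ≤ a → 0 ≤ b → a * b = 0 → φ a * φ b = 0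

/-- `(F, ψ, φ)` is an `(𝓕, ε)`-completely positive system for `A`. -/
def IsCPSystem (𝓕 : Set A) (ε : ℝ) (F : FinDimCStarAlgebra) (ψ : A →CP F) (φ : F →CP A) : Prop :=
  IsContractive ψ ∧ IsContractive φ ∧ ∀ a ∈ 𝓕, ‖φ (ψ a) - a‖ ≤ ε

/-- The linear map on `F⁽⁰⁾ ⊕ ⋯ ⊕ F⁽ᵈ⁾` whose restriction to `F⁽ⁱ⁾` is `φ i`. -/
def sumMap {d : ℕ} {F : Fin (d + 1) → FinDimCStarAlgebra} (φ : ∀ i, F i →CP A)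
    (x : FinDimCStarAlgebra.directSum F) : A :=
  ∑ i, φ i (x i)

/-- `(F, ψ, φ)` is a `(d, 𝓕, ε)`-decomposable system for `A`, where
`F = F⁽⁰⁾ ⊕ ⋯ ⊕ F⁽ᵈ⁾` and `φ` is given by its restrictions `φ i` to the summands. -/
def IsDecomposable (d : ℕ) (𝓕 : Set A) (ε : ℝ) (F : Fin (d + 1) → FinDimCStarAlgebra)
    (ψ : A →CP FinDimCStarAlgebra.directSum F) (φ : ∀ i, F i →CP A) : Prop :=
  IsContractive ψ ∧ (∀ i, IsContractive (φ i) ∧ IsOrderZero (φ i)) ∧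
    ∀ a ∈ 𝓕, ‖sumMap φ (ψ a) - a‖ ≤ ε

/-- A decomposable system is contractive if the sum map is contractive. -/
def IsContractiveDecomposable (d : ℕ) (𝓕 : Set A) (ε : ℝ) (F : Fin (d + 1) → FinDimCStarAlgebra)
    (ψ : A →CP FinDimCStarAlgebra.directSum F) (φ : ∀ i, F i →CP A) : Prop :=
  IsDecomposable d 𝓕 ε F ψ φ ∧ IsContractive (sumMap φ)

variable (A) in
/-- The nuclear dimension of `A` is at most `d`. -/
def NucDimLE (d : ℕ) : Prop :=
  ∀ (𝓕 : Finset A) (ε : ℝ), 0 < ε → ∃ F ψ φ, IsDecomposable d (𝓕 : Set A) ε F ψ φ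

variable (A) in
/-- The decomposition rank of `A` is at most `d`. -/
def DecRankLE (d : ℕ) : Prop :=
  ∀ (𝓕 : Finset A) (ε : ℝ), 0 < ε → ∃ F ψ φ, IsContractiveDecomposable d (𝓕 : Set A) ε F ψ φ

/-- The completely positive rank. -/
def rcp (𝓕 : Set A) (ε : ℝ) : ℕ∞ :=
  sInf {k | ∃ F ψ φ, IsCPSystem 𝓕 ε F ψ φ ∧ k = (F.rank : ℕ∞)}

/-- The decomposable rank. -/
def rnuc (d : ℕ) (𝓕 : Set A) (ε : ℝ) : ℕ∞ :=
  sInf {k | ∃ F ψ φ, IsDecomposable d 𝓕 ε F ψ φ ∧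
    k = ((FinDimCStarAlgebra.directSum F).rank : ℕ∞)}

/-- The contractive decomposable rank. -/
def rdr (d : ℕ) (𝓕 : Set A) (ε : ℝ) : ℕ∞ :=
  sInf {k | ∃ F ψ φ, IsContractiveDecomposable d 𝓕 ε F ψ φ ∧
    k = ((FinDimCStarAlgebra.directSum F).rank : ℕ∞)}

/-- The set `𝓕 ∪ α(𝓕) ∪ ⋯ ∪ αⁿ⁻¹(𝓕)`. -/
def orbit (α : A →⋆ₙₐ[ℂ] A) (𝓕 : Set A) (n : ℕ) : Set A := ⋃ j : Fin n, (α^[j]) '' 𝓕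

/-- The noncommutative entropy attached to a rank function `r 𝓕 ε`. -/
def entropyOfRank (r : Set A → ℝ → ℕ∞) (α : A →⋆ₙₐ[ℂ] A) : EReal :=
  ⨆ (𝓕 : Finset A) (ε : ℝ) (_ : 0 < ε), growth fun n ↦ r (orbit α 𝓕 n) ε

/-- The Brown–Voiculescu entropy of an endomorphism of a nuclear C⋆-algebra. -/
def ht (α : A →⋆ₙₐ[ℂ] A) : EReal := entropyOfRank rcp α

open Classical in
/-- Coloured entropy: the number of colours is the nuclear dimension of `A` plus one, and the value
is `⊤` if the nuclear dimension is infinite. -/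
def htNuc (α : A →⋆ₙₐ[ℂ] A) : EReal :=
  if h : ∃ d, NucDimLE A d then entropyOfRank (rnuc (Nat.find h)) α else ⊤

open Classical in
/-- Contractive coloured entropy: the number of colours is the decomposition rank of `A` plus one,
and the value is `⊤` if the decomposition rank is infinite. -/
def htDr (α : A →⋆ₙₐ[ℂ] A) : EReal :=
  if h : ∃ d, DecRankLE A d then entropyOfRank (rdr (Nat.find h)) α else ⊤

end Approximation

/-- The automorphism `f ↦ f ∘ T` of `C(X)` induced by a homeomorphism `T`. -/
def inducedAut {X : Type*} [TopologicalSpace X] (T : X ≃ₜ X) : C(X, ℂ) ≃⋆ₐ[ℂ] C(X, ℂ) :=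
  T.compStarAlgEquiv' ℂ ℂ

end

end ColouredEntropy

open ColouredEntropy

namespace ColouredEntropy

/-! All five quantities are squeezed between `topEntropy` and `htDr`: each of `ht` and `htNuc` lies
above the former and below the latter, and `htDr` is at most `colouredTopEntropy`, which equals
`topEntropy`.

Upper bound. In covering dimension `d` a finite open cover has a refinement in `d + 1` colours with
at most `d + 1` sets per set of a minimal subcover (`CoveringDimLE.exists_coloured`), so coloured
and ordinary counts differ by a bounded factor. Sampling functions at one point of each set of a
coloured cover and reassembling them with a subordinate partition of unity gives a contractive
decomposable system whose rank is at most the number of sets (`exists_isContractiveDecomposable`).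
Forgetting contractivity or the colours gives systems for `htNuc` and `ht`.

Lower bounds. Both start from a resolution of `1` into `rank F` minimal projections. With order zero
maps the system collapses to `rank F` positive functions, at most `d + 1` nonzero at any point, and
suitable superlevel sets form an open cover subordinate to every translated partition of unity at
once (`IsDecomposable.exists_cover`). The same cover bounds the covering dimension by the nuclear
dimension, so all the colour counts agree.

Without order zero only a trace estimate survives: the functionals induced on `C(X, ℝ)` can
distinguish at most about `rank F` disjoint sets. Hence few balls, for a squared distance summed
over an orbit segment, cover `X` (`exists_quadratic_net`). Closeness in this distance still permits
errors at a small proportion of times; a Hamming ball count shows that correcting them costs an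
arbitrarily small exponential rate. -/

theorem minSubcover_le {X : Type*} {𝒰 𝒱 : Set (Set X)} (h : 𝒱 ⊆ 𝒰) (hcov : ⋃₀ 𝒱 = univ) :
    minSubcover 𝒰 ≤ 𝒱.encard :=
  sInf_le ⟨𝒱, h, hcov, rfl⟩

theorem exists_minSubcover {X : Type*} {𝒰 : Set (Set X)} (hcov : ⋃₀ 𝒰 = univ) :
    ∃ 𝒱 ⊆ 𝒰, ⋃₀ 𝒱 = univ ∧ minSubcover 𝒰 = 𝒱.encard :=
  csInf_mem (s := {k | ∃ 𝒱 ⊆ 𝒰, ⋃₀ 𝒱 = univ ∧ k = 𝒱.encard})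
    ⟨_, 𝒰, Subset.rfl, hcov, rfl⟩

theorem one_le_minSubcover {X : Type*} [Nonempty X] (𝒰 : Set (Set X)) : 1 ≤ minSubcover 𝒰 := by
  refine le_sInf ?_
  rintro _ ⟨𝒱, -, h2, rfl⟩
  rw [one_le_encard_iff_nonempty]
  obtain ⟨x⟩ := ‹Nonempty X›
  obtain ⟨V, hV, -⟩ := mem_sUnion.1 (h2 ▸ mem_univ x : x ∈ ⋃₀ 𝒱)
  exact ⟨V, hV⟩

/-! ### Subcovers, coloured refinements and iterated covers. -/

section Covers

variable {X : Type*} [TopologicalSpace X]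

theorem coveringDimLE_toNat (hX : coveringDim X < ⊤) : CoveringDimLE X (coveringDim X).toNat := by
  have hne : {k : ℕ∞ | ∃ d : ℕ, CoveringDimLE X d ∧ k = d}.Nonempty := by
    by_contra hemp
    rw [Set.not_nonempty_iff_eq_empty] at hemp
    simp [coveringDim, hemp] at hX
  obtain ⟨d, hd, hk⟩ := csInf_mem hne
  have : coveringDim X = d := hk
  simpa [this] using hd

theorem coveringDim_toNat_le {d : ℕ} (h : CoveringDimLE X d) : (coveringDim X).toNat ≤ d := by
  have : coveringDim X ≤ d := sInf_le ⟨d, h, rfl⟩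
  exact ENat.toNat_le_of_le_natCast this

theorem exists_partitionOfUnity [NormalSpace X] {ι : Type*} [Fintype ι] {U : ι → Set X}
    (ho : ∀ i, IsOpen (U i)) (hc : ∀ x, ∃ i, x ∈ U i) :
    ∃ h : ι → C(X, ℝ), (∀ i x, 0 ≤ h i x) ∧ (∀ x, ∑ i, h i x = 1) ∧
      ∀ i x, h i x ≠ 0 → x ∈ U i := by
  obtain ⟨f, hf⟩ := PartitionOfUnity.exists_isSubordinate_of_locallyFinite isClosed_univ U ho
    (locallyFinite_of_finite U) (fun x _ ↦ mem_iUnion.2 (hc x))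
  refine ⟨fun i ↦ f i, fun i x ↦ f.nonneg i x, fun x ↦ ?_, fun i x hx ↦ ?_⟩
  · rw [← finsum_eq_sum_of_fintype]
    exact f.sum_eq_one (mem_univ x)
  · exact hf i (subset_tsupport _ hx)

/-- A finite open cover of a space of covering dimension at most `d` has a precise refinement of
order at most `d + 1`. -/
theorem CoveringDimLE.exists_precise {d : ℕ} (hd : CoveringDimLE X d) {ι : Type*} [Fintype ι]
    {U : ι → Set X} (ho : ∀ i, IsOpen (U i)) (hc : ∀ x, ∃ i, x ∈ U i) :
    ∃ G : ι → Set X, (∀ i, IsOpen (G i)) ∧ (∀ x, ∃ i, x ∈ G i) ∧ (∀ i, G i ⊆ U i) ∧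
      ∀ x, {i | x ∈ G i}.encard ≤ d + 1 := by
  obtain ⟨𝒱, -, ⟨⟨hV1, hV2⟩, hV3⟩, hV4⟩ := hd (range U) (finite_range U)
    ⟨by rintro _ ⟨i, rfl⟩; exact ho i, by
      rw [sUnion_range]; exact eq_univ_of_forall fun x ↦ mem_iUnion.2 (hc x)⟩
  have hr : ∀ V : 𝒱, ∃ i, (V : Set X) ⊆ U i := fun V ↦ by
    obtain ⟨_, ⟨i, rfl⟩, hi⟩ := hV3 V V.2
    exact ⟨i, hi⟩
  choose r hr using hr
  -- Members of `𝒱` assigned to the same index are merged; `r` maps the members through `x` onto the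
  -- indices `i` with `x ∈ G i`, so the order does not grow.
  refine ⟨fun i ↦ ⋃ (V : 𝒱) (_ : r V = i), (V : Set X), fun i ↦ ?_, fun x ↦ ?_, fun i ↦ ?_,
    fun x ↦ ?_⟩
  · exact isOpen_iUnion fun V ↦ isOpen_iUnion fun _ ↦ hV1 V V.2
  · obtain ⟨V, hV, hx⟩ := mem_sUnion.1 (hV2 ▸ mem_univ x : x ∈ ⋃₀ 𝒱)
    exact ⟨r ⟨V, hV⟩, mem_iUnion₂.2 ⟨⟨V, hV⟩, rfl, hx⟩⟩
  · exact iUnion₂_subset fun V hV ↦ hV ▸ hr V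
  · refine le_trans ?_ (hV4 x)
    have : {i | x ∈ ⋃ (V : 𝒱) (_ : r V = i), (V : Set X)} ⊆
        r '' (Subtype.val ⁻¹' {V ∈ 𝒱 | x ∈ V}) := by
      intro i hi
      obtain ⟨V, hV, hx⟩ := mem_iUnion₂.1 hi
      exact ⟨V, ⟨V.2, hx⟩, hV⟩
    refine (encard_le_encard this).trans ((encard_image_le _ _).trans ?_)
    rw [← Subtype.val_injective.encard_image]
    exact encard_le_encard (image_preimage_subset _ _)

/-- A finite open cover `U` of a normal space of covering dimension at most `d` has a
`(d + 1)`-coloured refinement in which every member of `U` contains at most one set of each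
colour. -/
theorem CoveringDimLE.exists_coloured [NormalSpace X] {d : ℕ} (hd : CoveringDimLE X d)
    {ι : Type*} [Fintype ι] {U : ι → Set X} (ho : ∀ i, IsOpen (U i)) (hc : ∀ x, ∃ i, x ∈ U i) :
    ∃ W : Fin (d + 1) → ι → Set X, (∀ k i, IsOpen (W k i)) ∧ (∀ x, ∃ k i, x ∈ W k i) ∧
      (∀ k i, W k i ⊆ U i) ∧ ∀ k i j, i ≠ j → Disjoint (W k i) (W k j) := by
  classical
  obtain ⟨G, hG1, hG2, hG3, hG4⟩ := hd.exists_precise ho hc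
  obtain ⟨h, h0, h1, hs⟩ := exists_partitionOfUnity hG1 hG2
  -- As in a barycentric subdivision: on `O σ` the weights in `σ` are positive and exceed all the
  -- others. Distinct sets of indices of equal size are incomparable, so their `O` are disjoint, and
  -- the size serves as colour.
  let O : Finset ι → Set X := fun σ ↦
    {x | (∀ s ∈ σ, 0 < h s x) ∧ ∀ s ∈ σ, ∀ t ∉ σ, h t x < h s x}
  have hO : ∀ σ, IsOpen (O σ) := by
    intro σ
    have : O σ = (⋂ s ∈ σ, {x | 0 < h s x}) ∩
        ⋂ s ∈ σ, ⋂ t ∈ (Finset.univ \ σ), {x | h t x < h s x} := by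
      ext x; simp [O]
    rw [this]
    refine IsOpen.inter (isOpen_biInter_finset fun s _ ↦ ?_)
      (isOpen_biInter_finset fun s _ ↦ isOpen_biInter_finset fun t _ ↦ ?_)
    · exact isOpen_lt continuous_const (h s).continuous
    · exact isOpen_lt (h t).continuous (h s).continuous
  have hdis : ∀ σ τ x, x ∈ O σ → x ∈ O τ → σ.card = τ.card → σ = τ := by
    intro σ τ x hσ hτ hcard
    by_contra hne
    have h1 : ¬ σ ⊆ τ := fun hsub ↦ hne (Finset.eq_of_subset_of_card_le hsub hcard.ge)
    have h2 : ¬ τ ⊆ σ := fun hsub ↦ hne (Finset.eq_of_subset_of_card_le hsub hcard.le).symm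
    obtain ⟨s, hs1, hs2⟩ := Finset.not_subset.1 h1
    obtain ⟨t, ht1, ht2⟩ := Finset.not_subset.1 h2
    exact lt_asymm (hσ.2 s hs1 t ht2) (hτ.2 t ht1 s hs2)
  -- Colour `k` collects the `σ` of size `k + 1`. Grouping them by a chosen vertex leaves one set
  -- for each colour and index.
  refine ⟨fun k i ↦ ⋃ (σ : Finset ι) (_ : σ.card = k + 1 ∧ ∃ hσ : σ.Nonempty, hσ.choose = i), O σ,
    fun k i ↦ isOpen_iUnion fun σ ↦ isOpen_iUnion fun _ ↦ hO σ, fun x ↦ ?_, fun k i ↦ ?_,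
    fun k i j hij ↦ ?_⟩
  -- The indices of nonzero weight at `x`: at most `d + 1` of them, by the order of `G`.
  · let σ : Finset ι := Finset.univ.filter fun i ↦ 0 < h i x
    have hne : σ.Nonempty := by
      by_contra hemp
      rw [Finset.not_nonempty_iff_eq_empty, Finset.filter_eq_empty_iff] at hemp
      have : ∑ i, h i x = 0 := Finset.sum_eq_zero fun i _ ↦
        le_antisymm (not_lt.1 (hemp (Finset.mem_univ i))) (h0 i x)
      linarith [h1 x]
    have hcard : σ.card ≤ d + 1 := by
      have h2 : (σ : Set ι) ⊆ {i | x ∈ G i} := fun i hi ↦ hs i x (by simpa [σ] using hi : _ < _).ne'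
      have h3 := (encard_le_encard h2).trans (hG4 x)
      rw [encard_coe_eq_coe_finsetCard] at h3
      exact_mod_cast h3
    have hpos := hne.card_pos
    refine ⟨⟨σ.card - 1, by omega⟩, hne.choose, mem_iUnion₂.2 ⟨σ, ⟨?_, hne, rfl⟩, ?_⟩⟩
    · simp only; omega
    · refine ⟨fun s hs ↦ by simpa [σ] using hs, fun s hs t ht ↦ ?_⟩
      have h4 : 0 < h s x := by simpa [σ] using hs
      have h5 : h t x ≤ 0 := by simpa [σ] using ht
      linarith
  · refine iUnion₂_subset ?_
    rintro σ ⟨-, hσ, rfl⟩ x hx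
    exact hG3 _ (hs _ x (hx.1 _ hσ.choose_spec).ne')
  · rw [Set.disjoint_left]
    intro x hx hy
    obtain ⟨σ, ⟨hσ1, hσ2, hσ3⟩, hσ4⟩ := mem_iUnion₂.1 hx
    obtain ⟨τ, ⟨hτ1, hτ2, hτ3⟩, hτ4⟩ := mem_iUnion₂.1 hy
    obtain rfl := hdis σ τ x hσ4 hτ4 (hσ1.trans hτ1.symm)
    exact hij (hσ3.symm.trans hτ3)

theorem minColouredRefinement_le_encard {𝒰 𝒱 : Set (Set X)} (h : IsRefinement 𝒱 𝒰)
    (hc : IsColoured ((coveringDim X).toNat + 1) 𝒱) : minColouredRefinement 𝒰 ≤ 𝒱.encard :=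
  sInf_le ⟨𝒱, h, hc, rfl⟩

theorem minSubcover_le_minColouredRefinement (𝒰 : Set (Set X)) :
    minSubcover 𝒰 ≤ minColouredRefinement 𝒰 := by
  refine le_sInf ?_
  rintro _ ⟨𝒱, ⟨⟨-, h2⟩, h3⟩, -, rfl⟩
  have hr : ∀ V : 𝒱, ∃ U ∈ 𝒰, (V : Set X) ⊆ U := fun V ↦ h3 V V.2
  choose r hr1 hr2 using hr
  refine (minSubcover_le (𝒱 := range r) (by rintro _ ⟨V, rfl⟩; exact hr1 V) ?_).trans ?_
  · refine eq_univ_of_forall fun x ↦ ?_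
    obtain ⟨V, hV, hx⟩ := mem_sUnion.1 (h2 ▸ mem_univ x : x ∈ ⋃₀ 𝒱)
    exact ⟨_, ⟨⟨V, hV⟩, rfl⟩, hr2 _ hx⟩
  · rw [← image_univ]
    exact (encard_image_le _ _).trans (by rw [encard_univ]; rfl)

/-- Colouring a minimal subcover rather than the whole cover produces one set per colour and member.
-/
theorem minColouredRefinement_le [NormalSpace X] (hX : coveringDim X < ⊤) {𝒰 : Set (Set X)}
    (hfin : 𝒰.Finite) (hcov : IsOpenCover 𝒰) :
    minColouredRefinement 𝒰 ≤ ((coveringDim X).toNat + 1 : ℕ) * minSubcover 𝒰 := by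
  obtain ⟨𝒱, h1, h2, h3⟩ := exists_minSubcover hcov.2
  have : Fintype 𝒱 := (hfin.subset h1).fintype
  obtain ⟨W, hW1, hW2, hW3, hW4⟩ := (coveringDimLE_toNat hX).exists_coloured
    (U := fun V : 𝒱 ↦ (V : Set X)) (fun V ↦ hcov.1 _ (h1 V.2)) (fun x ↦ by
      obtain ⟨V, hV, hx⟩ := mem_sUnion.1 (h2 ▸ mem_univ x : x ∈ ⋃₀ 𝒱)
      exact ⟨⟨V, hV⟩, hx⟩)
  refine (minColouredRefinement_le_encard (𝒱 := ⋃ k, range (W k)) ⟨⟨?_, ?_⟩, ?_⟩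
    ⟨fun k ↦ range (W k), fun k ↦ ?_, rfl⟩).trans ?_
  · simp only [mem_iUnion]
    rintro _ ⟨k, i, rfl⟩
    exact hW1 k i
  · refine eq_univ_of_forall fun x ↦ ?_
    obtain ⟨k, i, hx⟩ := hW2 x
    exact ⟨_, mem_iUnion.2 ⟨k, i, rfl⟩, hx⟩
  · simp only [mem_iUnion]
    rintro _ ⟨k, i, rfl⟩
    exact ⟨i, h1 i.2, hW3 k i⟩
  · rintro _ ⟨i, rfl⟩ _ ⟨j, rfl⟩ hij
    exact hW4 k i j fun h ↦ hij (h ▸ rfl)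
  · have : ⋃ k, range (W k) = range fun p : Fin ((coveringDim X).toNat + 1) × 𝒱 ↦ W p.1 p.2 := by
      ext; simp
    rw [h3, this, ← image_univ]
    refine (encard_image_le _ _).trans ?_
    simp only [encard_univ, ENat.card_eq_coe_fintype_card, Fintype.card_prod, Fintype.card_fin,
      Nat.cast_mul]
    rw [← ENat.card_eq_coe_fintype_card, ENat.card_coe_set_eq]

theorem dynCover_finite (T : X ≃ₜ X) {𝒰 : Set (Set X)} (hfin : 𝒰.Finite) (n : ℕ) :
    (dynCover T 𝒰 n).Finite := by
  have := hfin.to_subtype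
  refine (finite_range fun U : Fin n → 𝒰 ↦ ⋂ j : Fin n, (T^[j]) ⁻¹' (U j : Set X)).subset ?_
  rintro _ ⟨-, U, hU, rfl⟩
  exact ⟨fun j ↦ ⟨U j, hU j⟩, rfl⟩

theorem dynCover_isOpenCover (T : X ≃ₜ X) {𝒰 : Set (Set X)} (hcov : IsOpenCover 𝒰) (n : ℕ) :
    IsOpenCover (dynCover T 𝒰 n) := by
  constructor
  · rintro _ ⟨-, U, hU, rfl⟩
    exact isOpen_iInter_of_finite fun j ↦ (hcov.1 _ (hU j)).preimage (T.continuous.iterate j)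
  · refine eq_univ_of_forall fun x ↦ ?_
    have : ∀ j : Fin n, ∃ U ∈ 𝒰, T^[j] x ∈ U := fun j ↦ by
      simpa using (hcov.2 ▸ mem_univ (T^[j] x) : T^[j] x ∈ ⋃₀ 𝒰)
    choose U hU hx using this
    have hmem : x ∈ ⋂ j : Fin n, (T^[j]) ⁻¹' (U j) := mem_iInter.2 hx
    exact ⟨_, ⟨⟨x, hmem⟩, U, hU, rfl⟩, hmem⟩

/-- To bound the number of members needed in a subcover of `dynCover T 𝒰 n`, it suffices to find
words in `𝒰` of length `n` such that each point follows one of them. -/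
theorem minSubcover_dynCover_le (T : X ≃ₜ X) {𝒰 : Set (Set X)} {n : ℕ} {ι : Type*} [Fintype ι]
    (w : ι → Fin n → Set X) (hw : ∀ i j, w i j ∈ 𝒰)
    (hx : ∀ x, ∃ i, ∀ j : Fin n, T^[j] x ∈ w i j) :
    minSubcover (dynCover T 𝒰 n) ≤ Fintype.card ι := by
  let f : ι → Set X := fun i ↦ ⋂ j : Fin n, (T^[j]) ⁻¹' (w i j)
  -- Words that no point follows are dropped, since `dynCover` has only nonempty members.
  refine (minSubcover_le (𝒱 := f '' {i | (f i).Nonempty}) ?_ ?_).trans ?_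
  · rintro _ ⟨i, hi, rfl⟩
    exact ⟨hi, w i, hw i, rfl⟩
  · refine eq_univ_of_forall fun x ↦ ?_
    obtain ⟨i, hi⟩ := hx x
    have hmem : x ∈ f i := mem_iInter.2 hi
    exact ⟨_, ⟨i, ⟨x, hmem⟩, rfl⟩, hmem⟩
  · refine (encard_image_le _ _).trans ((encard_le_encard (subset_univ _)).trans ?_)
    simp [encard_univ]

/-- Converse of `minSubcover_dynCover_le`: with it, counting subcovers becomes counting words. -/
theorem exists_words (T : X ≃ₜ X) {𝒰 : Set (Set X)} (hfin : 𝒰.Finite) (hcov : IsOpenCover 𝒰)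
    (n : ℕ) : ∃ (k : ℕ) (w : Fin k → Fin n → Set X), minSubcover (dynCover T 𝒰 n) = k ∧
      (∀ i j, w i j ∈ 𝒰) ∧ ∀ x, ∃ i, ∀ j : Fin n, T^[j] x ∈ w i j := by
  obtain ⟨𝒱, h1, h2, h3⟩ := exists_minSubcover (dynCover_isOpenCover T hcov n).2
  have : Fintype 𝒱 := ((dynCover_finite T hfin n).subset h1).fintype
  have hw : ∀ V : 𝒱, ∃ U : Fin n → Set X, (∀ j, U j ∈ 𝒰) ∧
      (V : Set X) = ⋂ j : Fin n, (T^[j]) ⁻¹' (U j) := fun V ↦ (h1 V.2).2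
  choose w hw1 hw2 using hw
  let e := Fintype.equivFin 𝒱
  refine ⟨Fintype.card 𝒱, fun i ↦ w (e.symm i), ?_, fun i ↦ hw1 _, fun x ↦ ?_⟩
  · rw [h3, ← ENat.card_eq_coe_fintype_card, ENat.card_coe_set_eq]
  · obtain ⟨V, hV, hx⟩ := mem_sUnion.1 (h2 ▸ mem_univ x : x ∈ ⋃₀ 𝒱)
    refine ⟨e ⟨V, hV⟩, ?_⟩
    have : x ∈ ⋂ j : Fin n, (T^[j]) ⁻¹' (w ⟨V, hV⟩ j) := hw2 ⟨V, hV⟩ ▸ hx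
    simpa using this

/-- A word for the first `m` steps of `x` is concatenated with a word for the first `n` steps of
`T^[m] x`. -/
theorem minSubcover_dynCover_add_le (T : X ≃ₜ X) {𝒰 : Set (Set X)} (hfin : 𝒰.Finite)
    (hcov : IsOpenCover 𝒰) (m n : ℕ) :
    minSubcover (dynCover T 𝒰 (m + n)) ≤
      minSubcover (dynCover T 𝒰 m) * minSubcover (dynCover T 𝒰 n) := by
  obtain ⟨k, v, hk, hv1, hv2⟩ := exists_words T hfin hcov m
  obtain ⟨l, w, hl, hw1, hw2⟩ := exists_words T hfin hcov n
  rw [hk, hl]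
  refine (minSubcover_dynCover_le T (fun p : Fin k × Fin l ↦ Fin.append (v p.1) (w p.2))
    (fun p j ↦ ?_) fun x ↦ ?_).trans (by simp)
  · refine Fin.addCases (fun j ↦ ?_) (fun j ↦ ?_) j
    · simpa using hv1 _ _
    · simpa using hw1 _ _
  · obtain ⟨a, ha⟩ := hv2 x
    obtain ⟨b, hb⟩ := hw2 (T^[m] x)
    refine ⟨(a, b), Fin.addCases (fun j ↦ ?_) fun j ↦ ?_⟩
    · simpa using ha j
    · have := hb j
      rw [← Function.iterate_add_apply] at this
      simpa [add_comm] using this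

end Covers

end ColouredEntropy

/-! ### Exponential growth rates in the extended reals. -/

namespace ColouredEntropy

theorem growth_mono {u v : ℕ → ℕ∞} (h : ∀ᶠ n in atTop, u n ≤ v n) : growth u ≤ growth v := by
  refine limsup_le_limsup ?_
  filter_upwards [h] with n hn
  refine EReal.div_le_div_right_of_nonneg (by positivity) (ENNReal.log_le_log ?_)
  exact ENat.toENNReal_le.2 hn

theorem tendsto_log_div_const_add (c η : ℝ) :
    Tendsto (fun n : ℕ ↦ ((c + η * n : ℝ) : EReal) / (n : EReal)) atTop (𝓝 (η : EReal)) := by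
  have h1 : Tendsto (fun n : ℕ ↦ c / n + η) atTop (𝓝 η) := by
    simpa using (tendsto_const_div_atTop_nhds_zero_nat c).add_const η
  refine (EReal.tendsto_coe.2 h1).congr' ?_
  filter_upwards [eventually_gt_atTop 0] with n hn
  have : (n : ℝ) ≠ 0 := by positivity
  rw [← EReal.coe_natCast, ← EReal.coe_div]
  congr 1
  field_simp

theorem log_div_le_of_le_mul {u v : ℕ∞} {D η : ℝ} (hD : 0 < D) {n : ℕ}
    (h : (u : ℝ≥0∞) ≤ ENNReal.ofReal (D * Real.exp (η * n)) * v) :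
    ENNReal.log (u : ℝ≥0∞) / (n : EReal) ≤
      ((Real.log D + η * n : ℝ) : EReal) / (n : EReal) + ENNReal.log (v : ℝ≥0∞) / (n : EReal) := by
  have hn : (0 : EReal) ≤ n := by positivity
  rw [← EReal.add_div_of_nonneg_right hn]
  refine EReal.div_le_div_right_of_nonneg hn ((ENNReal.log_le_log h).trans_eq ?_)
  rw [ENNReal.log_mul_add, ENNReal.log_ofReal_of_pos (by positivity),
    Real.log_mul hD.ne' (Real.exp_pos _).ne', Real.log_exp]

/-- The factor `D` vanishes after taking logarithms and dividing by `n`, and the exponential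
contributes `η`. As this contribution is real, the bound for the limsup of a sum applies in `EReal`
even if `growth v` is infinite. -/
theorem growth_le_growth_add {u v : ℕ → ℕ∞} {D η : ℝ} (hD : 0 < D)
    (h : ∀ᶠ n : ℕ in atTop, (u n : ℝ≥0∞) ≤ ENNReal.ofReal (D * Real.exp (η * n)) * v n) :
    growth u ≤ growth v + η := by
  have hlim := (tendsto_log_div_const_add (Real.log D) η).limsup_eq
  have hle : growth u ≤ limsup ((fun n : ℕ ↦ ((Real.log D + η * n : ℝ) : EReal) / (n : EReal)) +
      fun n : ℕ ↦ ENNReal.log (v n : ℝ≥0∞) / (n : EReal)) atTop := by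
    refine limsup_le_limsup ?_
    filter_upwards [h] with n hn using log_div_le_of_le_mul hD hn
  refine hle.trans ((EReal.limsup_add_le ?_ ?_).trans_eq ?_)
  · exact Or.inl (hlim ▸ EReal.coe_ne_bot _)
  · exact Or.inl (hlim ▸ EReal.coe_ne_top _)
  · rw [hlim, add_comm]; rfl

theorem hasGrowthLimit_of_tendsto {u : ℕ → ℕ∞} {a : EReal}
    (h : Tendsto (fun n : ℕ ↦ ENNReal.log (u n : ℝ≥0∞) / (n : EReal)) atTop (𝓝 a)) :
    HasGrowthLimit u ∧ growth u = a := by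
  have : growth u = a := h.limsup_eq
  exact ⟨by rw [HasGrowthLimit, this]; exact h, this⟩

/-- Fekete's lemma for submultiplicative sequences. -/
theorem hasGrowthLimit_of_submultiplicative {u : ℕ → ℕ∞} (htop : ∀ n, u n ≠ ⊤)
    (hone : ∀ n, 1 ≤ u n) (hmul : ∀ m n, u (m + n) ≤ u m * u n) : HasGrowthLimit u := by
  lift u to ℕ → ℕ using htop
  have h1 : ∀ n, 1 ≤ u n := fun n ↦ by
    have := hone n
    simp only at this
    exact_mod_cast this
  have hpos : ∀ n, (0 : ℝ) < u n := fun n ↦ by exact_mod_cast h1 n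
  have hsub : Subadditive fun n ↦ Real.log (u n) := by
    intro m n
    rw [← Real.log_mul (hpos m).ne' (hpos n).ne']
    refine Real.log_le_log (hpos _) ?_
    have : u (m + n) ≤ u m * u n := by
      have := hmul m n
      simp only at this
      exact_mod_cast this
    exact_mod_cast this
  have hlim := hsub.tendsto_lim ⟨0, by
    rintro _ ⟨n, rfl⟩
    exact div_nonneg (Real.log_nonneg (by exact_mod_cast h1 n)) (by positivity)⟩
  refine (hasGrowthLimit_of_tendsto ((EReal.tendsto_coe.2 hlim).congr fun n ↦ ?_)).1
  rw [EReal.coe_div, EReal.coe_natCast, ENNReal.log_pos_real] <;>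
    simp [(zero_lt_one.trans_le (h1 n)).ne']

/-- Squeezing: the two bounds differ by `log C / n`, which tends to `0`. -/
theorem HasGrowthLimit.of_le_of_le_mul {u v : ℕ → ℕ∞} (hu : HasGrowthLimit u) {C : ℕ} (hC : 0 < C)
    (h1 : ∀ n, u n ≤ v n) (h2 : ∀ n, v n ≤ C * u n) : HasGrowthLimit v ∧ growth v = growth u := by
  refine hasGrowthLimit_of_tendsto (tendsto_of_tendsto_of_tendsto_of_le_of_le hu
    (h := fun n : ℕ ↦ ((Real.log C + 0 * n : ℝ) : EReal) / (n : EReal) +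
      ENNReal.log (u n : ℝ≥0∞) / (n : EReal)) ?_ (fun n ↦ ?_) fun n ↦ ?_)
  · have := (EReal.continuousAt_add (p := (((0 : ℝ) : EReal), growth u)) (by simp)
      (by simp)).tendsto.comp ((tendsto_log_div_const_add (Real.log C) 0).prodMk_nhds hu)
    simpa [Function.comp_def] using this
  · exact EReal.div_le_div_right_of_nonneg (by positivity)
      (ENNReal.log_le_log (ENat.toENNReal_le.2 (h1 n)))
  · refine log_div_le_of_le_mul (by exact_mod_cast hC) ?_
    have := ENat.toENNReal_le.2 (h2 n)
    simpa using this

theorem hasGrowthLimit_minSubcover {X : Type*} [TopologicalSpace X] [Nonempty X] (T : X ≃ₜ X)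
    {𝒰 : Set (Set X)} (hfin : 𝒰.Finite) (hcov : IsOpenCover 𝒰) :
    HasGrowthLimit fun n ↦ minSubcover (dynCover T 𝒰 n) := by
  refine hasGrowthLimit_of_submultiplicative (fun n ↦ ?_) (fun n ↦ one_le_minSubcover _)
    (minSubcover_dynCover_add_le T hfin hcov)
  obtain ⟨k, -, hk, -⟩ := exists_words T hfin hcov n
  rw [hk]
  exact ENat.natCast_ne_top k

theorem hasGrowthLimit_minColouredRefinement {X : Type*} [TopologicalSpace X] [NormalSpace X]
    [Nonempty X] (hX : coveringDim X < ⊤) (T : X ≃ₜ X) {𝒰 : Set (Set X)} (hfin : 𝒰.Finite)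
    (hcov : IsOpenCover 𝒰) :
    (HasGrowthLimit fun n ↦ minColouredRefinement (dynCover T 𝒰 n)) ∧
      (growth fun n ↦ minColouredRefinement (dynCover T 𝒰 n)) =
        growth fun n ↦ minSubcover (dynCover T 𝒰 n) :=
  (hasGrowthLimit_minSubcover T hfin hcov).of_le_of_le_mul (Nat.succ_pos _)
    (fun _ ↦ minSubcover_le_minColouredRefinement _)
    fun n ↦ minColouredRefinement_le hX (dynCover_finite T hfin n) (dynCover_isOpenCover T hcov n)

theorem colouredTopEntropy_eq_topEntropy {X : Type*} [TopologicalSpace X] [NormalSpace X]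
    [Nonempty X] (hX : coveringDim X < ⊤) (T : X ≃ₜ X) :
    colouredTopEntropy T = topEntropy T := by
  unfold colouredTopEntropy topEntropy
  refine iSup_congr fun 𝒰 ↦ iSup_congr fun hfin ↦ iSup_congr fun hcov ↦ ?_
  exact (hasGrowthLimit_minColouredRefinement hX T hfin hcov).2

end ColouredEntropy

/-! ### Minimal projections in finite-dimensional C⋆-algebras. -/

namespace ColouredEntropy

-- Characters are linearly independent in the finite-dimensional dual.
open WeakDual in
theorem finite_characterSpace (C : Type*) [CommCStarAlgebra C] [FiniteDimensional ℂ C] :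
    Finite (characterSpace ℂ C) := by
  have h := (linearIndependent_algHom_toLinearMap ℂ C ℂ)
  have : Finite (C →ₐ[ℂ] ℂ) := h.finite
  exact Finite.of_injective (fun φ : characterSpace ℂ C ↦ CharacterSpace.toAlgHom φ) (fun φ ψ h ↦ by
    ext a; exact congr($h a))

open WeakDual in
/-- A commutative finite-dimensional C⋆-algebra is spanned by orthogonal minimal projections. -/
theorem exists_minimal_projections_comm (C : Type*) [CommCStarAlgebra C] [FiniteDimensional ℂ C] :
    ∃ (e : Fin (Module.finrank ℂ C) → C) (χ : Fin (Module.finrank ℂ C) → C →ₗ[ℂ] ℂ),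
      (∀ l, star (e l) = e l) ∧ (∀ l, e l * e l = e l) ∧ (∀ l m, l ≠ m → e l * e m = 0) ∧
      ∑ l, e l = 1 ∧ (∀ l, e l ≠ 0) ∧ ∀ l b, e l * b = χ l b • e l := by
  classical
  have := finite_characterSpace C
  have := Fintype.ofFinite (characterSpace ℂ C)
  let G := gelfandStarTransform C
  have hcard : Fintype.card (characterSpace ℂ C) = Module.finrank ℂ C := by
    let L : C ≃ₗ[ℂ] (characterSpace ℂ C → ℂ) :=
      G.toAlgEquiv.toLinearEquiv.trans
        { ContinuousMap.equivFnOfDiscrete with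
          map_add' := fun _ _ ↦ rfl
          map_smul' := fun _ _ ↦ rfl }
    rw [L.finrank_eq, Module.finrank_fintype_fun_eq_card]
  let y := (Fintype.equivFinOfCardEq hcard).symm
  -- By Gelfand duality `C` is the algebra of functions on a finite discrete space; `e l` is the
  -- indicator of the point `y l`.
  let e : Fin (Module.finrank ℂ C) → C := fun l ↦
    G.symm (ContinuousMap.equivFnOfDiscrete.symm (Pi.single (y l) 1))
  have hG : ∀ l, G (e l) = ContinuousMap.equivFnOfDiscrete.symm (Pi.single (y l) 1) :=
    fun l ↦ G.apply_symm_apply _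
  have hGx : ∀ l x, G (e l) x = Pi.single (M := fun _ ↦ ℂ) (y l) 1 x := fun l x ↦ by rw [hG]; rfl
  refine ⟨e, fun l ↦ (CharacterSpace.toAlgHom (y l)).toLinearMap, fun l ↦ ?_, fun l ↦ ?_,
    fun l m hlm ↦ ?_, ?_, fun l h ↦ ?_, fun l b ↦ ?_⟩
  · apply EquivLike.injective G
    ext x
    rw [map_star, ContinuousMap.star_apply, hGx]
    by_cases h : x = y l <;> simp [h]
  · apply EquivLike.injective G
    ext x
    rw [map_mul, ContinuousMap.mul_apply, hGx]
    by_cases h : x = y l <;> simp [h]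
  · apply EquivLike.injective G
    ext x
    rw [map_mul, ContinuousMap.mul_apply, hGx, hGx, map_zero]
    by_cases h : x = y l
    · have : y l ≠ y m := fun h' ↦ hlm (y.injective h')
      simp [h, this]
    · simp [h]
  · apply EquivLike.injective G
    ext x
    rw [map_sum, ContinuousMap.sum_apply, map_one]
    simp_rw [hGx, Pi.single_apply]
    rw [y.sum_comp (fun z ↦ if x = z then (1 : ℂ) else 0)]
    simp
  · have := hGx l (y l)
    simp [h] at this
  · apply EquivLike.injective G
    ext x
    rw [map_mul, ContinuousMap.mul_apply, map_smul, ContinuousMap.smul_apply, hGx]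
    by_cases h : x = y l
    · subst h
      simp [G]
    · simp [h]

/-- A commutative ⋆-subalgebra of largest dimension is maximal; the scalars show that there is one
to start from. -/
theorem exists_isMaximalAbelian (F : Type*) [CStarAlgebra F] [FiniteDimensional ℂ F] :
    ∃ B : StarSubalgebra ℂ F, IsMaximalAbelian B := by
  let S : Set ℕ := {k | ∃ B : StarSubalgebra ℂ F,
    (∀ x ∈ B, ∀ y ∈ B, x * y = y * x) ∧ Module.finrank ℂ B = k}
  have hne : S.Nonempty := by
    refine ⟨_, ⊥, fun x hx y hy ↦ ?_, rfl⟩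
    obtain ⟨c, rfl⟩ := StarSubalgebra.mem_bot.1 hx
    exact Algebra.commutes c y
  have hbdd : BddAbove S := by
    refine ⟨Module.finrank ℂ F, ?_⟩
    rintro _ ⟨B, -, rfl⟩
    exact Submodule.finrank_le (Subalgebra.toSubmodule B.toSubalgebra)
  obtain ⟨B, hB, hmax⟩ := Nat.sSup_mem hne hbdd
  refine ⟨B, hB, fun C hC hBC ↦ ?_⟩
  have h1 : Subalgebra.toSubmodule B.toSubalgebra ≤ Subalgebra.toSubmodule C.toSubalgebra := hBC
  have h2 : Module.finrank ℂ C ≤ Module.finrank ℂ B := hmax ▸ le_csSup hbdd ⟨C, hC, rfl⟩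
  have h3 := Submodule.eq_of_le_of_finrank_le h1 h2
  intro x hx
  have : x ∈ Subalgebra.toSubmodule B.toSubalgebra := h3 ▸ hx
  exact this

/-- Adjoining `z` to `B` keeps it commutative because `z` is its own adjoint, so maximality applies.
-/
theorem IsMaximalAbelian.mem_of_isSelfAdjoint {F : Type*} [CStarAlgebra F]
    {B : StarSubalgebra ℂ F} (hB : IsMaximalAbelian B) {z : F} (hz : IsSelfAdjoint z)
    (hcomm : ∀ b ∈ B, z * b = b * z) : z ∈ B := by
  let C := StarAlgebra.adjoin ℂ ((B : Set F) ∪ {z})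
  have hC : IsMulCommutative C := by
    have key : ∀ a ∈ (B : Set F) ∪ {z}, ∀ b ∈ (B : Set F) ∪ {z}, a * b = b * a := by
      rintro a (ha | rfl) b (hb | rfl)
      · exact hB.1 a ha b hb
      · exact (hcomm a ha).symm
      · exact hcomm b hb
      · rfl
    refine StarAlgebra.isMulCommutative_adjoin ℂ key fun a ha b hb ↦ key a ha _ ?_
    rcases hb with hb | rfl
    · exact Or.inl (star_mem (S := StarSubalgebra ℂ F) hb)
    · exact Or.inr hz.star_eq
  have h1 : B ≤ C := fun b hb ↦ StarAlgebra.subset_adjoin ℂ _ (Or.inl hb)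
  have h2 : C ≤ B := hB.2 (fun x hx y hy ↦ setLike_mul_comm hx hy) h1
  exact h2 (StarAlgebra.subset_adjoin ℂ _ (Or.inr rfl))

/-- A resolution of the identity into orthogonal minimal projections `e l` of a C⋆-algebra;
`coeff l` is the functional given by `e l * a * e l = coeff l a • e l`. -/
structure MinimalResolution (F : Type*) [CStarAlgebra F] (k : ℕ) where
  e : Fin k → F
  coeff : Fin k → F →ₗ[ℂ] ℂ
  star_e : ∀ l, star (e l) = e l
  mul_self : ∀ l, e l * e l = e l
  mul_of_ne : ∀ l m, l ≠ m → e l * e m = 0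
  sum_e : ∑ l, e l = 1
  e_ne_zero : ∀ l, e l ≠ 0
  compress : ∀ l a, e l * a * e l = coeff l a • e l

/-- Projections minimal in `B` are minimal in `F`: for self-adjoint `a` the compression `e l * a * e
l` commutes with `B`, hence lies in `B` and is a multiple of `e l`. General `a` splits into real and
imaginary parts. -/
theorem IsMaximalAbelian.exists_minimalResolution {F : Type*} [CStarAlgebra F]
    [FiniteDimensional ℂ F] {B : StarSubalgebra ℂ F} (hB : IsMaximalAbelian B) :
    Nonempty (MinimalResolution F (Module.finrank ℂ B)) := by
  have hcl : IsClosed (B : Set F) :=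
    (Subalgebra.toSubmodule B.toSubalgebra).closed_of_finiteDimensional
  let _ : CommCStarAlgebra B :=
    { StarSubalgebra.cstarAlgebra B with
      mul_comm := fun x y ↦ Subtype.ext (hB.1 x x.2 y y.2) }
  have : FiniteDimensional ℂ B :=
    inferInstanceAs (FiniteDimensional ℂ (Subalgebra.toSubmodule B.toSubalgebra))
  obtain ⟨e, χ, h1, h2, h3, h4, h5, h6⟩ := exists_minimal_projections_comm B
  have hstar : ∀ l, star (e l : F) = e l := fun l ↦ congr_arg Subtype.val (h1 l)
  have hmem_sa : ∀ l (a : F), IsSelfAdjoint a → (e l : F) * a * e l ∈ B := by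
    intro l a ha
    refine hB.mem_of_isSelfAdjoint ?_ fun b hb ↦ ?_
    · rw [IsSelfAdjoint, star_mul, star_mul, hstar, ha.star_eq, mul_assoc]
    · have hb1 : (e l : F) * b = χ l ⟨b, hb⟩ • (e l : F) := congr_arg Subtype.val (h6 l ⟨b, hb⟩)
      have hb2 : b * (e l : F) = χ l ⟨b, hb⟩ • (e l : F) := by rw [hB.1 b hb _ (e l).2, hb1]
      rw [mul_assoc, hb1, mul_smul_comm, ← mul_assoc, ← mul_assoc, hb2, smul_mul_assoc,
        smul_mul_assoc]
  have hmem : ∀ l (a : F), (e l : F) * a * e l ∈ B := by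
    intro l a
    rw [← realPart_add_I_smul_imaginaryPart a]
    simp only [mul_add, add_mul, mul_smul_comm, smul_mul_assoc]
    exact add_mem (hmem_sa l _ (realPart a).2)
      (SMulMemClass.smul_mem _ (hmem_sa l _ (imaginaryPart a).2))
  let p : Fin (Module.finrank ℂ B) → F →ₗ[ℂ] B := fun l ↦
    { toFun := fun a ↦ ⟨(e l : F) * a * e l, hmem l a⟩
      map_add' := fun a b ↦ Subtype.ext (by
        change (e l : F) * (a + b) * e l = (e l : F) * a * e l + (e l : F) * b * e l
        rw [mul_add, add_mul])
      map_smul' := fun c a ↦ Subtype.ext (by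
        change (e l : F) * (c • a) * e l = c • ((e l : F) * a * e l)
        rw [mul_smul_comm, smul_mul_assoc]) }
  refine ⟨⟨fun l ↦ e l, fun l ↦ (χ l).comp (p l), hstar, fun l ↦ congr_arg Subtype.val (h2 l),
    fun l m hlm ↦ congr_arg Subtype.val (h3 l m hlm), ?_, fun l h ↦ h5 l (Subtype.ext h),
    fun l a ↦ ?_⟩⟩
  · have := congr_arg (Subalgebra.val B.toSubalgebra) h4
    rw [map_sum] at this
    exact this
  · have h7 : (e l : F) * ((e l : F) * a * e l) = χ l ⟨_, hmem l a⟩ • (e l : F) :=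
      congr_arg Subtype.val (h6 l ⟨(e l : F) * a * e l, hmem l a⟩)
    have h8 : (e l : F) * e l = e l := congr_arg Subtype.val (h2 l)
    rw [← mul_assoc, ← mul_assoc, h8] at h7
    exact h7

/-- The infimum defining `rank` is attained; that all maximal abelian subalgebras have the same
dimension is not needed. -/
theorem FinDimCStarAlgebra.exists_minimalResolution (F : FinDimCStarAlgebra) :
    Nonempty (MinimalResolution F F.rank) := by
  obtain ⟨B₀, hB₀⟩ := exists_isMaximalAbelian F
  obtain ⟨B, hB, hk⟩ := Nat.sInf_mem (s := {k | ∃ B : StarSubalgebra ℂ F,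
    IsMaximalAbelian B ∧ k = Module.finrank ℂ B}) ⟨_, B₀, hB₀, rfl⟩
  rw [FinDimCStarAlgebra.rank, hk]
  exact hB.exists_minimalResolution

theorem FinDimCStarAlgebra.rank_le_finrank (F : FinDimCStarAlgebra) :
    F.rank ≤ Module.finrank ℂ F := by
  obtain ⟨B, hB⟩ := exists_isMaximalAbelian F
  refine (Nat.sInf_le ⟨B, hB, rfl⟩ : F.rank ≤ _).trans ?_
  exact Submodule.finrank_le (Subalgebra.toSubmodule B.toSubalgebra)

namespace MinimalResolution

variable {F : Type*} [CStarAlgebra F] {k : ℕ} (R : MinimalResolution F k)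

theorem coeff_one (l : Fin k) : R.coeff l 1 = 1 := by
  have h := R.compress l 1
  rw [mul_one, R.mul_self] at h
  have : (R.coeff l 1 - 1) • R.e l = 0 := by rw [sub_smul, one_smul, ← h, sub_self]
  exact sub_eq_zero.1 ((smul_eq_zero.1 this).resolve_right (R.e_ne_zero l))

theorem norm_e (l : Fin k) : ‖R.e l‖ = 1 := by
  have h := CStarRing.norm_star_mul_self (x := R.e l)
  rw [R.star_e, R.mul_self] at h
  exact (mul_left_cancel₀ (norm_ne_zero_iff.2 (R.e_ne_zero l)) (h.symm.trans (mul_one _).symm))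

variable [PartialOrder F] [StarOrderedRing F]

theorem e_nonneg (l : Fin k) : 0 ≤ R.e l := by
  have := star_mul_self_nonneg (R.e l)
  rwa [R.star_e, R.mul_self] at this

theorem coeff_nonneg (l : Fin k) {a : F} (ha : 0 ≤ a) : 0 ≤ R.coeff l a := by
  have h : 0 ≤ R.coeff l a • R.e l := by
    have := star_left_conjugate_nonneg ha (R.e l)
    rwa [R.star_e, R.compress] at this
  set c := R.coeff l a
  have hsa := (IsSelfAdjoint.of_nonneg h).star_eq
  rw [star_smul, R.star_e] at hsa
  have hc : star c = c := sub_eq_zero.1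
    ((smul_eq_zero.1 (by rw [sub_smul, hsa, sub_self] : (star c - c) • R.e l = 0)).resolve_right
      (R.e_ne_zero l))
  have hre : ((c.re : ℝ) : ℂ) = c := Complex.conj_eq_iff_re.1 hc
  rw [← hre] at h ⊢
  rw [Complex.coe_smul] at h
  rw [Complex.zero_le_real]
  by_contra! hneg
  have h2 : c.re • R.e l ≤ 0 := smul_nonpos_of_nonpos_of_nonneg hneg.le (R.e_nonneg l)
  exact hneg.ne ((smul_eq_zero.1 (le_antisymm h2 h)).resolve_right (R.e_ne_zero l))

/-- The norm of a positive element is at most its trace. -/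
theorem norm_le_sum_coeff {a : F} (ha : 0 ≤ a) : ‖a‖ ≤ ∑ l, (R.coeff l a).re := by
  obtain ⟨c, rfl⟩ := CStarAlgebra.nonneg_iff_eq_star_mul_self.1 ha
  -- `c * star c` has the same norm as `star c * c` and is a sum of terms of norm `‖e l * (star c *
  -- c) * e l‖`.
  have h1 : c * star c = ∑ l, c * R.e l * star (c * R.e l) := by
    simp_rw [star_mul, R.star_e]
    calc c * star c = c * (∑ l, R.e l) * star c := by rw [R.sum_e, mul_one]
      _ = _ := by
        rw [Finset.mul_sum, Finset.sum_mul]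
        refine Finset.sum_congr rfl fun l _ ↦ ?_
        rw [mul_assoc c (R.e l) (R.e l * star c), ← mul_assoc (R.e l) (R.e l), R.mul_self,
          mul_assoc]
  have h2 : ‖star c * c‖ = ‖c * star c‖ := by
    rw [CStarRing.norm_star_mul_self, CStarRing.norm_self_mul_star]
  rw [h2, h1]
  refine (norm_sum_le _ _).trans (Finset.sum_le_sum fun l _ ↦ ?_)
  rw [CStarRing.norm_self_mul_star, ← CStarRing.norm_star_mul_self, star_mul, R.star_e, mul_assoc,
    ← mul_assoc (star c), ← mul_assoc, R.compress, norm_smul, R.norm_e, mul_one]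
  exact (Complex.re_eq_norm.2 (R.coeff_nonneg l ha)).ge

end MinimalResolution

end ColouredEntropy

/-! ### Functionals and functions extracted from approximating systems. -/

namespace ColouredEntropy

section Functionals

variable {F : Type*} [CStarAlgebra F] [PartialOrder F] [StarOrderedRing F]

/-- The Cauchy–Schwarz inequality for the semi-inner product of the GNS construction. -/
theorem positive_star_mul_eq_zero (ω : F →ₚ[ℂ] ℂ) {a : F} (ha : ω (star a * a) = 0) (b : F) :
    ω (star a * b) = 0 ∧ ω (star b * a) = 0 := by
  have h0 : ‖ω.toPreGNS a‖ = 0 := by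
    have h := ω.preGNS_norm_sq (ω.toPreGNS a)
    rw [PositiveLinearMap.ofPreGNS_toPreGNS, ha] at h
    exact_mod_cast pow_eq_zero_iff (two_ne_zero) |>.1 (by exact_mod_cast h)
  have h1 := norm_inner_le_norm (𝕜 := ℂ) (ω.toPreGNS a) (ω.toPreGNS b)
  have h2 := norm_inner_le_norm (𝕜 := ℂ) (ω.toPreGNS b) (ω.toPreGNS a)
  rw [h0, PositiveLinearMap.preGNS_inner_def] at h1 h2
  simp only [PositiveLinearMap.ofPreGNS_toPreGNS, zero_mul, mul_zero, norm_le_zero_iff] at h1 h2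
  exact ⟨h1, h2⟩

/-- A positive functional that does not vanish on at most one of the minimal projections of a
resolution of the identity is determined by the compressions to these projections. -/
theorem MinimalResolution.positive_apply_eq_sum {k : ℕ} (R : MinimalResolution F k) (ω : F →ₚ[ℂ] ℂ)
    (h : ∀ l m, l ≠ m → ω (R.e l) * ω (R.e m) = 0) (a : F) :
    ω a = ∑ l, R.coeff l a * ω (R.e l) := by
  have hz : ∀ l, ω (R.e l) = 0 → ∀ b, ω (R.e l * b) = 0 ∧ ω (b * R.e l) = 0 := by
    intro l hl b
    have h1 := positive_star_mul_eq_zero ω (a := R.e l) (by rw [R.star_e, R.mul_self, hl])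
    refine ⟨?_, ?_⟩
    · simpa [R.star_e] using (h1 b).1
    · simpa using (h1 (star b)).2
  -- `ω` vanishes on `e l` or on `e m`, hence on every product that begins with the former or ends
  -- with the latter: only diagonal blocks remain.
  have hoff : ∀ l m, l ≠ m → ω (R.e l * a * R.e m) = 0 := by
    intro l m hlm
    rcases mul_eq_zero.1 (h l m hlm) with h1 | h1
    · rw [mul_assoc]; exact (hz l h1 _).1
    · exact (hz m h1 _).2
  have ha : a = ∑ l, ∑ m, R.e l * a * R.e m := by
    simp_rw [← Finset.mul_sum, R.sum_e, mul_one, ← Finset.sum_mul, R.sum_e, one_mul]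
  conv_lhs => rw [ha]
  rw [map_sum]
  refine Finset.sum_congr rfl fun l _ ↦ ?_
  rw [map_sum, Finset.sum_eq_single l (fun m _ hm ↦ hoff l m hm.symm) (by simp), R.compress,
    map_smul, smul_eq_mul]

end Functionals

section Systems

variable {X : Type*} [TopologicalSpace X]

/-- The inclusion of the real functions into the complex functions. -/
def complexify : C(X, ℝ) →ₗ[ℝ] C(X, ℂ) where
  toFun f := ⟨fun x ↦ (f x : ℂ), by fun_prop⟩
  map_add' f g := by ext; simp
  map_smul' c f := by ext; simp

@[simp]
theorem complexify_apply (f : C(X, ℝ)) (x : X) : complexify f x = (f x : ℂ) := rfl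

theorem complexify_one : complexify (1 : C(X, ℝ)) = 1 := by ext; simp

theorem complexify_nonneg {f : C(X, ℝ)} (hf : 0 ≤ f) : 0 ≤ complexify f := by
  intro x
  simpa using hf x

variable [CompactSpace X]

theorem abs_re_sub_le_of_norm_sub_le {f : C(X, ℝ)} {g : C(X, ℂ)} {ε : ℝ}
    (h : ‖g - complexify f‖ ≤ ε) (x : X) : |(g x).re - f x| ≤ ε := by
  have h1 := (ContinuousMap.norm_coe_le_norm (g - complexify f) x).trans h
  refine le_trans ?_ h1
  simpa using Complex.abs_re_le_norm (g x - f x)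

/-- A completely positive system of rank `k` gives rise to positive functionals approximating the
point evaluations, with the property that at most `k` disjoint sets can be distinguished. -/
theorem IsCPSystem.exists_functionals {𝓖 : Set C(X, ℂ)} {ε : ℝ} {F : FinDimCStarAlgebra}
    {ψ : C(X, ℂ) →CP F} {φ : F →CP C(X, ℂ)} (h : IsCPSystem 𝓖 ε F ψ φ) :
    ∃ ν : X → C(X, ℝ) →ₗ[ℝ] ℝ, (∀ x f, 0 ≤ f → 0 ≤ ν x f) ∧
      (∀ x f, complexify f ∈ 𝓖 → |ν x f - f x| ≤ ε) ∧
      ∀ (s : Finset X) (f : X → C(X, ℝ)), (∀ x ∈ s, 0 ≤ f x) → ∑ x ∈ s, f x ≤ 1 →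
        ∑ x ∈ s, ν x (f x) ≤ F.rank := by
  obtain ⟨R⟩ := F.exists_minimalResolution
  obtain ⟨hψ, hφ, happ⟩ := h
  have hpos : ∀ f : C(X, ℝ), 0 ≤ f → 0 ≤ ψ (complexify f) := fun f hf ↦
    map_nonneg ψ (complexify_nonneg hf)
  have hψ1 : ψ 1 ≤ 1 := by
    have h0 : 0 ≤ ψ 1 := by
      have := hpos 1 zero_le_one
      rwa [complexify_one] at this
    rw [← CStarAlgebra.norm_le_one_iff_of_nonneg _ h0]
    refine (hψ 1).trans ?_
    rw [ContinuousMap.norm_le _ zero_le_one]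
    simp
  refine ⟨fun x ↦
    { toFun := fun f ↦ (φ (ψ (complexify f)) x).re
      map_add' := fun f g ↦ by simp
      map_smul' := fun c f ↦ by
        rw [map_smul, ← Complex.coe_smul, map_smul, map_smul]; simp }, fun x f hf ↦ ?_,
    fun x f hf ↦ abs_re_sub_le_of_norm_sub_le (happ _ hf) x, fun s f hf hsum ↦ ?_⟩
  · have : 0 ≤ φ (ψ (complexify f)) := map_nonneg φ (hpos f hf)
    exact (Complex.le_def.1 (this x)).1
  -- The trace bound for `φ` evaluated at `x` no longer depends on `x`, so the `f x` can be summed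
  -- inside `ψ`; as `ψ` of their sum is at most `1`, each minimal projection contributes at most
  -- `1`.
  · calc ∑ x ∈ s, (φ (ψ (complexify (f x))) x).re
        ≤ ∑ x ∈ s, ∑ l, (R.coeff l (ψ (complexify (f x)))).re := by
          refine Finset.sum_le_sum fun x hx ↦ ?_
          refine le_trans ?_ (R.norm_le_sum_coeff (hpos _ (hf x hx)))
          refine (Complex.re_le_norm _).trans ((ContinuousMap.norm_coe_le_norm _ x).trans (hφ _))
      _ = ∑ l, (R.coeff l (ψ (complexify (∑ x ∈ s, f x)))).re := by
          rw [Finset.sum_comm]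
          simp only [map_sum, Complex.re_sum]
      _ ≤ ∑ l : Fin F.rank, 1 := by
          refine Finset.sum_le_sum fun l _ ↦ ?_
          have h1 : 0 ≤ R.coeff l (1 - ψ (complexify (∑ x ∈ s, f x))) := by
            refine R.coeff_nonneg l (sub_nonneg.2 (le_trans ?_ hψ1))
            have := hpos _ (sub_nonneg.2 hsum)
            rwa [map_sub, complexify_one, map_sub, sub_nonneg] at this
          rw [map_sub, R.coeff_one] at h1
          have := (Complex.le_def.1 h1).1
          simpa using this
      _ = F.rank := by simp

/-- A decomposable system of rank `k` with `d + 1` colours is, up to `ε`, given by `k` positive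
functions, at most `d + 1` of which do not vanish at any given point. -/
theorem IsDecomposable.exists_functions {d : ℕ} {𝓖 : Set C(X, ℂ)} {ε : ℝ}
    {F : Fin (d + 1) → FinDimCStarAlgebra} {ψ : C(X, ℂ) →CP FinDimCStarAlgebra.directSum F}
    {φ : ∀ i, F i →CP C(X, ℂ)} (h : IsDecomposable d 𝓖 ε F ψ φ) :
    ∃ (g : Fin (FinDimCStarAlgebra.directSum F).rank → C(X, ℝ))
      (μ : Fin (FinDimCStarAlgebra.directSum F).rank → C(X, ℝ) →ₗ[ℝ] ℝ),
      (∀ l, 0 ≤ g l) ∧ (∀ l f, 0 ≤ f → 0 ≤ μ l f) ∧ (∀ x, {l | g l x ≠ 0}.encard ≤ d + 1) ∧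
      ∀ f, complexify f ∈ 𝓖 → ∀ x, |∑ l, g l x * μ l f - f x| ≤ ε := by
  obtain ⟨R⟩ := (FinDimCStarAlgebra.directSum F).exists_minimalResolution
  obtain ⟨-, hφ, happ⟩ := h
  let ω : Fin (d + 1) → X → FinDimCStarAlgebra.directSum F →ₚ[ℂ] ℂ := fun i x ↦
    PositiveLinearMap.mk₀
      { toFun := fun a ↦ φ i (a i) x
        map_add' := fun a b ↦ by
          change φ i (a i + b i) x = _
          simp
        map_smul' := fun c a ↦ by
          change φ i (c • a i) x = _
          simp } fun a ha ↦ by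
      have h1 : 0 ≤ φ i (a i) := map_nonneg (φ i) (ha i)
      exact h1 x
  have hω : ∀ i x a, ω i x a = φ i (a i) x := fun _ _ _ ↦ rfl
  -- Order zero enters here: at a fixed point, each colour sees at most one minimal projection.
  have horth : ∀ i x l m, l ≠ m → ω i x (R.e l) * ω i x (R.e m) = 0 := by
    intro i x l m hlm
    have h1 := (hφ i).2 (R.e l i) (R.e m i) (R.e_nonneg l i) (R.e_nonneg m i)
      (congr_fun (R.mul_of_ne l m hlm) i)
    exact congr($h1 x)
  have hωpos : ∀ i x l, 0 ≤ ω i x (R.e l) := fun i x l ↦ (ω i x).map_nonneg (R.e_nonneg l)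
  let g : Fin (FinDimCStarAlgebra.directSum F).rank → C(X, ℝ) := fun l ↦
    ⟨fun x ↦ ∑ i, (φ i (R.e l i) x).re, by fun_prop⟩
  have hg : ∀ l x, g l x = ∑ i, (ω i x (R.e l)).re := fun _ _ ↦ rfl
  refine ⟨g, fun l ↦
    { toFun := fun f ↦ (R.coeff l (ψ (complexify f))).re
      map_add' := fun f g ↦ by simp
      map_smul' := fun c f ↦ by
        rw [map_smul, ← Complex.coe_smul, map_smul, map_smul]; simp }, fun l x ↦ ?_,
    fun l f hf ↦ ?_, fun x ↦ ?_, fun f hf x ↦ ?_⟩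
  · change (0 : ℝ) ≤ ∑ i, (ω i x (R.e l)).re
    exact Finset.sum_nonneg fun i _ ↦ (Complex.le_def.1 (hωpos i x l)).1
  · exact (Complex.le_def.1 (R.coeff_nonneg l (map_nonneg ψ (complexify_nonneg hf)))).1
  -- A colour that does not kill `e l` at `x` determines `l`, so the number of such `l` is at most
  -- the number of colours.
  · have hex : ∀ l, g l x ≠ 0 → ∃ i, ω i x (R.e l) ≠ 0 := by
      intro l hl
      by_contra! hcon
      exact hl (by rw [hg]; simp [hcon])
    choose! c hc using hex
    have hinj : InjOn c {l | g l x ≠ 0} := by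
      intro l hl m hm hlm
      by_contra hne
      rcases mul_eq_zero.1 (horth (c l) x l m hne) with h1 | h1
      · exact hc l hl h1
      · exact hc m hm (hlm ▸ h1)
    refine (encard_le_encard_of_injOn (t := univ) (fun _ _ ↦ mem_univ _) hinj).trans ?_
    simp [encard_univ]
  · have h1 := abs_re_sub_le_of_norm_sub_le (happ _ hf) x
    convert h1 using 3
    have h2 : sumMap φ (ψ (complexify f)) x = ∑ i, ω i x (ψ (complexify f)) := by
      simp only [sumMap, ContinuousMap.sum_apply]
      rfl
    rw [h2, Complex.re_sum]
    have h3 : ∀ i, (ω i x (ψ (complexify f))).re =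
        ∑ l, (ω i x (R.e l)).re * (R.coeff l (ψ (complexify f))).re := by
      intro i
      rw [R.positive_apply_eq_sum (ω i x) (horth i x), Complex.re_sum]
      refine Finset.sum_congr rfl fun l _ ↦ ?_
      have := (Complex.le_def.1 (hωpos i x l)).2
      simp only [Complex.zero_im] at this
      rw [Complex.mul_re, ← this]
      ring
    simp_rw [h3]
    rw [Finset.sum_comm]
    refine Finset.sum_congr rfl fun l _ ↦ ?_
    rw [hg, Finset.sum_mul]
    rfl

end Systems

end ColouredEntropy

/-! ### Covers from decomposable systems: dimension and the lower bound for `htNuc`. -/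

namespace ColouredEntropy

theorem IsOpenCover.exists_partitionOfUnity {X : Type*} [TopologicalSpace X] [NormalSpace X]
    [Nonempty X] {𝒰 : Set (Set X)} [Fintype 𝒰] (hcov : IsOpenCover 𝒰) :
    Nonempty 𝒰 ∧ ∃ q : 𝒰 → C(X, ℝ), (∀ U x, 0 ≤ q U x) ∧ (∀ x, ∑ U, q U x = 1) ∧
      ∀ U x, q U x ≠ 0 → x ∈ (U : Set X) := by
  have hex : ∀ x, ∃ U : 𝒰, x ∈ (U : Set X) := fun x ↦ by
    obtain ⟨V, hV, hx⟩ := mem_sUnion.1 (hcov.2 ▸ mem_univ x : x ∈ ⋃₀ 𝒰)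
    exact ⟨⟨V, hV⟩, hx⟩
  exact ⟨⟨(hex (Classical.arbitrary X)).choose⟩,
    ColouredEntropy.exists_partitionOfUnity (fun U ↦ hcov.1 U U.2) hex⟩

section Decomposable

variable {X : Type*} [TopologicalSpace X] [CompactSpace X]

/-- A decomposable system that nearly fixes the members of a family of partitions of unity yields an
open cover of small order which is subordinate to each of these partitions. -/
theorem IsDecomposable.exists_cover {d : ℕ} {𝓖 : Set C(X, ℂ)} {ε : ℝ}
    {F : Fin (d + 1) → FinDimCStarAlgebra} {ψ : C(X, ℂ) →CP FinDimCStarAlgebra.directSum F}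
    {φ : ∀ i, F i →CP C(X, ℂ)} (h : IsDecomposable d 𝓖 ε F ψ φ) {J ι : Type*} [Fintype ι]
    [Nonempty ι] (q : J → ι → C(X, ℝ)) (hq0 : ∀ j u, 0 ≤ q j u) (hq1 : ∀ j, ∑ u, q j u = 1)
    (h1 : (1 : C(X, ℂ)) ∈ 𝓖) (hq : ∀ j u, complexify (q j u) ∈ 𝓖)
    (hε : ε * (2 * (d + 1) * Fintype.card ι) < 1) :
    ∃ V : Fin (FinDimCStarAlgebra.directSum F).rank → Set X, (∀ l, IsOpen (V l)) ∧
      (∀ x, ∃ l, x ∈ V l) ∧ (∀ x, {l | x ∈ V l}.encard ≤ d + 1) ∧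
      ∀ l j, ∃ u, ∀ x ∈ V l, q j u x ≠ 0 := by
  obtain ⟨g, μ, hg, hμ, hord, happ⟩ := h.exists_functions
  have hp : (1 : ℝ) ≤ Fintype.card ι := by exact_mod_cast Fintype.card_pos (α := ι)
  have hd : (0 : ℝ) < d + 1 := by positivity
  have hg' : ∀ l x, 0 ≤ g l x := fun l x ↦ hg l x
  have hμ1 : ∀ l, 0 ≤ μ l 1 := fun l ↦ hμ l 1 zero_le_one
  have hV : ∀ l x, 1 / (2 * (d + 1 : ℝ)) < g l x * μ l 1 → g l x ≠ 0 := by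
    intro l x hlt h0
    rw [h0, zero_mul] at hlt
    have : 0 < 1 / (2 * (d + 1 : ℝ)) := by positivity
    linarith
  -- At most `d + 1` terms are nonzero at `x`; if none exceeded `1 / (2 * (d + 1))`, their sum would
  -- be at most `1 / 2`, whereas it is at least `1 - ε` and `hε` forces `ε < 1 / 2`.
  refine ⟨fun l ↦ {x | 1 / (2 * (d + 1 : ℝ)) < g l x * μ l 1}, fun l ↦ ?_, fun x ↦ ?_, fun x ↦ ?_,
    fun l j ↦ ?_⟩
  · exact isOpen_lt continuous_const ((g l).continuous.mul continuous_const)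
  · by_contra! hcon
    have hcon' : ∀ l, g l x * μ l 1 ≤ 1 / (2 * (d + 1 : ℝ)) := fun l ↦ not_lt.1 (hcon l)
    have h2 := abs_le.1 (happ 1 (by rwa [complexify_one]) x)
    rw [ContinuousMap.one_apply] at h2
    have hcard : ((Finset.univ.filter fun l ↦ g l x ≠ 0).card : ℝ) ≤ d + 1 := by
      have := hord x
      rw [← Finset.coe_filter_univ, encard_coe_eq_coe_finsetCard] at this
      exact_mod_cast this
    have h3 : ∑ l, g l x * μ l 1 ≤ 1 / 2 := by
      calc ∑ l, g l x * μ l 1 = ∑ l with g l x ≠ 0, g l x * μ l 1 := by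
            rw [Finset.sum_filter_of_ne]
            intro l _ h
            exact left_ne_zero_of_mul h
        _ ≤ ∑ l with g l x ≠ 0, 1 / (2 * (d + 1 : ℝ)) := Finset.sum_le_sum fun l _ ↦ hcon' l
        _ ≤ (d + 1) * (1 / (2 * (d + 1 : ℝ))) := by
            rw [Finset.sum_const, nsmul_eq_mul]
            gcongr
        _ = 1 / 2 := by field_simp
    have h4 : 1 / 2 ≤ ε := by linarith [h2.1]
    have h5 : (2 : ℝ) ≤ 2 * (d + 1) * Fintype.card ι := by nlinarith
    nlinarith
  · refine (encard_le_encard fun l hl ↦ ?_).trans (hord x)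
    exact hV l x hl
  -- The `u` carrying the largest share of `μ l 1` depends on `l` and `j` only. Were `q j u` zero at
  -- a point of `V l`, the term `g l x * μ l (q j u)` would be at most `ε`, too small for the
  -- threshold.
  · obtain ⟨u, -, hu⟩ := Finset.exists_max_image Finset.univ (fun u ↦ μ l (q j u))
      Finset.univ_nonempty
    have hle : μ l 1 ≤ Fintype.card ι * μ l (q j u) := by
      rw [← hq1 j, map_sum, ← nsmul_eq_mul]
      exact Finset.sum_le_card_nsmul _ _ _ fun v hv ↦ hu v hv
    refine ⟨u, fun x hx h0 ↦ ?_⟩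
    have h2 := (abs_le.1 (happ _ (hq j u) x)).2
    rw [h0, sub_zero] at h2
    have h3 : g l x * μ l (q j u) ≤ ε := le_trans (Finset.single_le_sum
      (f := fun v ↦ g v x * μ v (q j u)) (fun v _ ↦ mul_nonneg (hg' v x) (hμ v _ (hq0 j u)))
      (Finset.mem_univ l)) h2
    have h4 : 1 / (2 * (d + 1 : ℝ)) < Fintype.card ι * ε := by
      calc 1 / (2 * (d + 1 : ℝ)) < g l x * μ l 1 := hx
        _ ≤ g l x * (Fintype.card ι * μ l (q j u)) := by gcongr; exact hg' l x
        _ = Fintype.card ι * (g l x * μ l (q j u)) := by ring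
        _ ≤ Fintype.card ι * ε := by gcongr
    rw [div_lt_iff₀ (by positivity)] at h4
    linarith

/-- The case of a single partition of unity. Together with `CoveringDimLE.decRankLE` it makes the
three dimensions equal. -/
theorem NucDimLE.coveringDimLE [NormalSpace X] [Nonempty X] {d : ℕ} (h : NucDimLE C(X, ℂ) d) :
    CoveringDimLE X d := by
  intro 𝒰 hfin hcov
  have := hfin.fintype
  obtain ⟨_, q, hq0, hq1, hq2⟩ := hcov.exists_partitionOfUnity
  have hD : (0 : ℝ) < 2 * (d + 1) * Fintype.card 𝒰 := by
    have := Fintype.card_pos (α := 𝒰)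
    positivity
  obtain ⟨F, ψ, φ, hdec⟩ := h ((finite_range fun u ↦ complexify (q u)).insert 1).toFinset
    (1 / (2 * (2 * (d + 1) * Fintype.card 𝒰))) (by positivity)
  obtain ⟨V, hV1, hV2, hV3, hV4⟩ := hdec.exists_cover (J := Unit) (fun _ ↦ q)
    (fun _ u x ↦ hq0 u x) (fun _ ↦ by ext x; simpa using hq1 x) (by simp) (by simp) (by
      rw [one_div, mul_inv, mul_assoc, inv_mul_cancel₀ hD.ne']; norm_num)
  refine ⟨range V, finite_range V, ⟨⟨?_, ?_⟩, ?_⟩, fun x ↦ ?_⟩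
  · rintro _ ⟨l, rfl⟩
    exact hV1 l
  · refine eq_univ_of_forall fun x ↦ ?_
    obtain ⟨l, hl⟩ := hV2 x
    exact ⟨_, ⟨l, rfl⟩, hl⟩
  · rintro _ ⟨l, rfl⟩
    obtain ⟨u, hu⟩ := hV4 l ()
    exact ⟨u, u.2, fun x hx ↦ hq2 u x (hu x hx)⟩
  · refine le_trans (encard_le_encard ?_) ((encard_image_le V _).trans (hV3 x))
    rintro _ ⟨⟨l, rfl⟩, hx⟩
    exact ⟨l, hx, rfl⟩

end Decomposable

section Dynamics

variable {X : Type*} [TopologicalSpace X]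

/-- The automorphism induced by a homeomorphism, as an endomorphism. -/
noncomputable abbrev inducedEnd (T : X ≃ₜ X) : C(X, ℂ) →⋆ₙₐ[ℂ] C(X, ℂ) :=
  (inducedAut T : C(X, ℂ) →⋆ₙₐ[ℂ] C(X, ℂ))

/-- The function `f ∘ Tʲ`. -/
def translate (T : X ≃ₜ X) (j : ℕ) (f : C(X, ℝ)) : C(X, ℝ) := f.comp ⟨T^[j], T.continuous.iterate j⟩

@[simp]
theorem translate_apply (T : X ≃ₜ X) (j : ℕ) (f : C(X, ℝ)) (x : X) :
    translate T j f x = f (T^[j] x) := rfl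

theorem inducedEnd_iterate_apply (T : X ≃ₜ X) (j : ℕ) (f : C(X, ℂ)) (x : X) :
    (inducedEnd T)^[j] f x = f (T^[j] x) := by
  induction j generalizing f with
  | zero => rfl
  | succ j ih =>
    rw [Function.iterate_succ_apply, ih, Function.iterate_succ_apply']
    rfl

variable [CompactSpace X]

theorem complexify_translate_mem_orbit (T : X ≃ₜ X) {𝓕 : Set C(X, ℂ)} {f : C(X, ℝ)}
    (hf : complexify f ∈ 𝓕) {n : ℕ} (j : Fin n) :
    complexify (translate T j f) ∈ orbit (inducedEnd T) 𝓕 n := by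
  refine mem_iUnion.2 ⟨j, complexify f, hf, ?_⟩
  ext x
  rw [inducedEnd_iterate_apply]
  rfl

theorem one_mem_orbit (T : X ≃ₜ X) {𝓕 : Set C(X, ℂ)} (hf : 1 ∈ 𝓕) {n : ℕ} (hn : 0 < n) :
    1 ∈ orbit (inducedEnd T) 𝓕 n :=
  mem_iUnion.2 ⟨⟨0, hn⟩, 1, hf, rfl⟩

/-- The tolerance in `IsDecomposable.exists_cover` does not involve the number of partitions, so one
`ε` serves the partitions `q ∘ Tʲ` for all `n`, and each set of the cover receives a word. -/
theorem topEntropy_le_entropyOfRank_rnuc [NormalSpace X] [Nonempty X] (T : X ≃ₜ X) (d : ℕ) :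
    topEntropy T ≤ entropyOfRank (rnuc d) (inducedEnd T) := by
  refine iSup_le fun 𝒰 ↦ iSup_le fun hfin ↦ iSup_le fun hcov ↦ ?_
  have := hfin.fintype
  obtain ⟨_, q, hq0, hq1, hq2⟩ := hcov.exists_partitionOfUnity
  have hD : (0 : ℝ) < 2 * (d + 1) * Fintype.card 𝒰 := by
    have := Fintype.card_pos (α := 𝒰)
    positivity
  let 𝓕 : Finset C(X, ℂ) := ((finite_range fun u ↦ complexify (q u)).insert 1).toFinset
  let ε : ℝ := 1 / (2 * (2 * (d + 1) * Fintype.card 𝒰))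
  refine le_trans ?_ (le_iSup_of_le 𝓕 (le_iSup_of_le ε (le_iSup_of_le
    (by positivity : 0 < ε) le_rfl)))
  refine growth_mono ?_
  -- For `n = 0` the orbit is empty and would not contain `1`.
  filter_upwards [eventually_gt_atTop 0] with n hn
  refine le_sInf ?_
  rintro _ ⟨F, ψ, φ, hdec, rfl⟩
  obtain ⟨V, -, hV2, -, hV4⟩ := hdec.exists_cover (J := Fin n) (fun j u ↦ translate T j (q u))
    (fun _ u x ↦ hq0 u _) (fun j ↦ by ext x; simpa using hq1 _)
    (one_mem_orbit T (by simp [𝓕]) hn)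
    (fun j u ↦ complexify_translate_mem_orbit T (by simp [𝓕]) j) (by
      simp only [ε]
      rw [one_div, mul_inv, mul_assoc, inv_mul_cancel₀ hD.ne']; norm_num)
  choose w hw using hV4
  refine (minSubcover_dynCover_le T (fun l j ↦ (w l j : Set X)) (fun l j ↦ (w l j).2)
    fun x ↦ ?_).trans (by simp)
  obtain ⟨l, hl⟩ := hV2 x
  exact ⟨l, fun j ↦ hq2 _ _ (hw l j x hl)⟩

end Dynamics

end ColouredEntropy

/-! ### Hamming balls and separated sets. -/

namespace ColouredEntropy

section Hamming

/-- The number of words at normalized Hamming distance at most `θ` from a given word. -/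
theorem card_hammingBall_le {ι : Type*} [Fintype ι] [DecidableEq ι] {n : ℕ} (c : Fin n → ι)
    {θ s : ℝ} (hs0 : 0 < s) (hs1 : s ≤ 1) :
    ((Finset.univ.filter fun w : Fin n → ι ↦
      ((Finset.univ.filter fun j ↦ w j ≠ c j).card : ℝ) ≤ θ * n).card : ℝ) ≤
      Real.exp ((-θ * Real.log s + Fintype.card ι * s) * n) := by
  set E := Finset.univ.filter fun w : Fin n → ι ↦
      ((Finset.univ.filter fun j ↦ w j ≠ c j).card : ℝ) ≤ θ * n
  -- A Chernoff bound: weighting each error by `s` makes the total weight a product over positions,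
  -- while every word in the ball has weight at least `s ^ (θ * n)`.
  have h1 : ∑ w : Fin n → ι, s ^ (Finset.univ.filter fun j ↦ w j ≠ c j).card ≤
      Real.exp (Fintype.card ι * s * n) := by
    calc ∑ w : Fin n → ι, s ^ (Finset.univ.filter fun j ↦ w j ≠ c j).card
        = ∑ w : Fin n → ι, ∏ j, (if w j ≠ c j then s else 1) := by
          refine Finset.sum_congr rfl fun w _ ↦ ?_
          rw [Finset.prod_ite, Finset.prod_const, Finset.prod_const_one, mul_one]
      _ = ∏ j : Fin n, ∑ i : ι, (if i ≠ c j then s else 1) := by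
          rw [Finset.prod_univ_sum, Fintype.piFinset_univ]
      _ ≤ ∏ j : Fin n, Real.exp (Fintype.card ι * s) := by
          refine Finset.prod_le_prod (fun j _ ↦ Finset.sum_nonneg fun i _ ↦ ?_) fun j _ ↦ ?_
          · split_ifs <;> positivity
          · calc ∑ i : ι, (if i ≠ c j then s else 1)
                ≤ ∑ i : ι, (s + if i = c j then 1 else 0) := by
                  refine Finset.sum_le_sum fun i _ ↦ ?_
                  split_ifs <;> simp_all; linarith
              _ = Fintype.card ι * s + 1 := by simp [Finset.sum_add_distrib]
              _ ≤ _ := Real.add_one_le_exp _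
      _ = Real.exp (Fintype.card ι * s * n) := by
          rw [Finset.prod_const, Finset.card_univ, Fintype.card_fin, ← Real.exp_nat_mul]
          ring_nf
  have h2 : (E.card : ℝ) * Real.exp (θ * n * Real.log s) ≤ Real.exp (Fintype.card ι * s * n) := by
    refine le_trans ?_ h1
    rw [← nsmul_eq_mul, ← Finset.sum_const]
    refine le_trans (Finset.sum_le_sum fun w hw ↦ ?_)
      (Finset.sum_le_univ_sum_of_nonneg (s := E) fun w ↦ by positivity)
    rw [← Real.exp_log (pow_pos hs0 _), Real.log_pow, Real.exp_le_exp]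
    exact mul_le_mul_of_nonpos_right (Finset.mem_filter.1 hw).2 (Real.log_nonpos hs0.le hs1)
  rw [← le_div_iff₀ (Real.exp_pos _), ← Real.exp_sub] at h2
  refine h2.trans_eq ?_
  ring_nf

/-- If each point follows, up to a proportion `θ` of errors, the itinerary of one of the points of
`E`, then `dynCover T 𝒰 n` has a subcover of cardinality not much larger than that of `E`. -/
theorem exists_minSubcover_le_hamming {X : Type*} [TopologicalSpace X] (T : X ≃ₜ X)
    {𝒰 : Set (Set X)} [Fintype 𝒰] (hcov : ⋃₀ 𝒰 = univ) {n : ℕ} (E : Finset X)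
    (c : X → Fin n → 𝒰) {θ s : ℝ} (hs0 : 0 < s) (hs1 : s ≤ 1)
    (hE : ∀ z, ∃ x ∈ E, ∃ J : Finset (Fin n), (J.card : ℝ) ≤ θ * n ∧
      ∀ j ∉ J, T^[j] z ∈ (c x j : Set X)) :
    ∃ M : ℕ, minSubcover (dynCover T 𝒰 n) ≤ M ∧
      (M : ℝ) ≤ E.card * Real.exp ((-θ * Real.log s + Fintype.card 𝒰 * s) * n) := by
  classical
  let W : X → Finset (Fin n → 𝒰) := fun x ↦ Finset.univ.filter fun w ↦
    ((Finset.univ.filter fun j ↦ w j ≠ c x j).card : ℝ) ≤ θ * n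
  refine ⟨Fintype.card (Σ x : E, W x), minSubcover_dynCover_le T
    (fun p j ↦ ((p.2 : Fin n → 𝒰) j : Set X)) (fun p j ↦ ((p.2 : Fin n → 𝒰) j).2) fun z ↦ ?_, ?_⟩
  · have hex : ∀ j : Fin n, ∃ U : 𝒰, T^[j] z ∈ (U : Set X) := fun j ↦ by
      obtain ⟨V, hV, hx⟩ := mem_sUnion.1 (hcov ▸ mem_univ (T^[j] z) : T^[j] z ∈ ⋃₀ 𝒰)
      exact ⟨⟨V, hV⟩, hx⟩
    choose v hv using hex
    obtain ⟨x, hx, J, hJ, hgood⟩ := hE z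
    -- The word of `x`, corrected at the bad times by sets that do contain the orbit of `z`.
    have hmem : (fun j ↦ if j ∈ J then v j else c x j) ∈ W x := by
      refine Finset.mem_filter.2 ⟨Finset.mem_univ _, le_trans ?_ hJ⟩
      refine Nat.cast_le.2 (Finset.card_le_card fun j hj ↦ ?_)
      by_contra hjJ
      simp [hjJ] at hj
    refine ⟨⟨⟨x, hx⟩, ⟨_, hmem⟩⟩, fun j ↦ ?_⟩
    by_cases hj : j ∈ J
    · simpa [hj] using hv j
    · simpa [hj] using hgood j hj
  · rw [Fintype.card_sigma, Nat.cast_sum]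
    calc ∑ x : E, (Fintype.card (W x) : ℝ)
        ≤ ∑ x : E, Real.exp ((-θ * Real.log s + Fintype.card 𝒰 * s) * n) := by
          refine Finset.sum_le_sum fun x _ ↦ ?_
          rw [Fintype.card_coe]
          exact card_hammingBall_le (c x) hs0 hs1
      _ = _ := by simp

end Hamming

section Separated

variable {X : Type*} [TopologicalSpace X]

/-- Let `ν x` be positive functionals approximating the evaluation at `x` on finitely many functions
`q i` and their squares, and suppose that the `ν x` can distinguish at most `k` disjoint sets. Then
`X` is covered by at most `2 * k` balls for the quadratic distance defined by the `q i`. -/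
theorem exists_quadratic_net {k : ℕ} {ε : ℝ} (ν : X → C(X, ℝ) →ₗ[ℝ] ℝ)
    (hν0 : ∀ x f, 0 ≤ f → 0 ≤ ν x f)
    (hk : ∀ (s : Finset X) (f : X → C(X, ℝ)), (∀ x ∈ s, 0 ≤ f x) → ∑ x ∈ s, f x ≤ 1 →
      ∑ x ∈ s, ν x (f x) ≤ k)
    {I : Type*} [Fintype I] (q : I → C(X, ℝ)) (hq0 : ∀ i x, 0 ≤ q i x) (hq1 : ∀ i x, q i x ≤ 1)
    (h1 : ∀ x, |ν x 1 - 1| ≤ ε) (h2 : ∀ i x, |ν x (q i) - q i x| ≤ ε)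
    (h3 : ∀ i x, |ν x (q i * q i) - q i x * q i x| ≤ ε) {σ : ℝ} (hσ : 0 < σ)
    (hε : ε + 4 * Fintype.card I * ε / σ ≤ 1 / 2) :
    ∃ E : Finset X, E.card ≤ 2 * k ∧
      ∀ z, ∃ x ∈ E, ∑ i, (q i x - q i z) ^ 2 < 4 * σ := by
  classical
  let S : X → X → ℝ := fun x y ↦ ∑ i, (q i x - q i y) ^ 2
  -- `S x` expanded as a combination of `q i * q i`, `q i` and `1`. On these `ν x` is close to
  -- evaluation at `x`, where `D x` vanishes.
  let D : X → C(X, ℝ) := fun x ↦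
    ∑ i, (q i * q i - (2 * q i x) • q i + (q i x * q i x) • (1 : C(X, ℝ)))
  have hD : ∀ x y, D x y = S x y := by
    intro x y
    simp only [D, S, ContinuousMap.sum_apply]
    refine Finset.sum_congr rfl fun i _ ↦ ?_
    simp
    ring
  have hνD : ∀ x, ν x (D x) ≤ 4 * Fintype.card I * ε := by
    intro x
    have : ν x (D x) ≤ ∑ i : I, 4 * ε := by
      simp only [D, map_sum]
      refine Finset.sum_le_sum fun i _ ↦ ?_
      rw [map_add, map_sub, map_smul, map_smul, smul_eq_mul, smul_eq_mul]
      have e1 := abs_le.1 (h1 x)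
      have e2 := abs_le.1 (h2 i x)
      have e3 := abs_le.1 (h3 i x)
      have a0 := hq0 i x
      have a1 := hq1 i x
      have hε0 : 0 ≤ ε := (abs_nonneg _).trans (h1 x)
      have b1 : 0 ≤ q i x * (ν x (q i) - q i x + ε) := mul_nonneg a0 (by linarith)
      have b2 : 0 ≤ q i x * q i x * (ε - (ν x 1 - 1)) := mul_nonneg (mul_nonneg a0 a0) (by linarith)
      have b3 : q i x * ε ≤ ε := mul_le_of_le_one_left hε0 a1
      have b4 : q i x * q i x * ε ≤ ε := mul_le_of_le_one_left hε0 (mul_le_one₀ a1 a0 a1)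
      nlinarith
    refine this.trans_eq ?_
    rw [Finset.sum_const, nsmul_eq_mul, Finset.card_univ]
    ring
  -- A bump supported near `x` that dominates `1 - σ⁻¹ • D x`, so that `ν x` gives it mass at least
  -- `1 / 2`.
  let f : X → C(X, ℝ) := fun x ↦ 0 ⊔ (1 - σ⁻¹ • D x)
  have hf : ∀ x y, f x y = max 0 (1 - σ⁻¹ * S x y) := fun x y ↦ by
    simp [f, ← hD]
  have hS0 : ∀ x y, 0 ≤ S x y := fun x y ↦ Finset.sum_nonneg fun i _ ↦ sq_nonneg _
  have hf1 : ∀ x y, f x y ≤ 1 := fun x y ↦ by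
    rw [hf]
    have := mul_nonneg (inv_nonneg.2 hσ.le) (hS0 x y)
    exact max_le zero_le_one (by linarith)
  have hfS : ∀ x y, f x y ≠ 0 → S x y < σ := fun x y hxy ↦ by
    by_contra! hcon
    refine hxy ?_
    rw [hf, max_eq_left]
    have : 1 ≤ σ⁻¹ * S x y := by rw [inv_mul_eq_div, one_le_div hσ]; exact hcon
    linarith
  have hνf : ∀ x, 1 / 2 ≤ ν x (f x) := by
    intro x
    have e0 : 0 ≤ ν x (f x - (1 - σ⁻¹ • D x)) := hν0 x _ (sub_nonneg.2 le_sup_right)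
    rw [map_sub, map_sub, map_smul, smul_eq_mul] at e0
    have e1 := abs_le.1 (h1 x)
    have e2 : σ⁻¹ * ν x (D x) ≤ 4 * Fintype.card I * ε / σ := by
      rw [div_eq_inv_mul]
      exact mul_le_mul_of_nonneg_left (hνD x) (inv_nonneg.2 hσ.le)
    linarith [e1.1]
  -- The balls `S x < σ` around points of `E` are disjoint. Then the bumps add up to at most `1`,
  -- and `hk` bounds the cardinality.
  let P : Finset X → Prop := fun E ↦ ∀ x ∈ E, ∀ y ∈ E, ∀ z, S x z < σ → S y z < σ → x = y
  have hPcard : ∀ E, P E → E.card ≤ 2 * k := by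
    intro E hE
    have e1 : ∑ x ∈ E, f x ≤ 1 := by
      intro z
      change (∑ x ∈ E, f x) z ≤ (1 : C(X, ℝ)) z
      rw [ContinuousMap.sum_apply, ContinuousMap.one_apply]
      by_cases hz : ∃ x ∈ E, f x z ≠ 0
      · obtain ⟨x, hx, hxz⟩ := hz
        rw [Finset.sum_eq_single_of_mem x hx]
        · exact hf1 x z
        · intro y hy hyx
          by_contra hyz
          exact hyx (hE y hy x hx z (hfS y z hyz) (hfS x z hxz))
      · push Not at hz
        rw [Finset.sum_eq_zero hz]
        exact zero_le_one
    have e2 := hk E f (fun x _ ↦ le_sup_left) e1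
    have e3 : (E.card : ℝ) * (1 / 2) ≤ ∑ x ∈ E, ν x (f x) := by
      rw [← nsmul_eq_mul]
      exact Finset.card_nsmul_le_sum _ _ _ fun x _ ↦ hνf x
    have : (E.card : ℝ) ≤ 2 * k := by linarith
    exact_mod_cast this
  obtain ⟨E, hE, hmax⟩ := Nat.sSup_mem (s := {m | ∃ E, P E ∧ E.card = m}) ⟨_, ∅, by simp [P], rfl⟩
    ⟨2 * k, by rintro _ ⟨E, hE, rfl⟩; exact hPcard E hE⟩
  refine ⟨E, hPcard E hE, fun z ↦ ?_⟩
  by_contra! hcon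
  have hzE : z ∉ E := fun hz ↦ by
    have := hcon z hz
    simp at this
    linarith
  -- `S` is a squared distance, so `(a + b) ^ 2 ≤ 2 * a ^ 2 + 2 * b ^ 2` yields the factor `4`:
  -- otherwise `z` could not be added to a maximal `E`.
  have hdisj : ∀ x ∈ E, ∀ y, S x y < σ → ¬ S z y < σ := by
    intro x hx y e1 e2
    have : S x z ≤ 2 * (S x y + S z y) := by
      simp only [S]
      rw [← Finset.sum_add_distrib, Finset.mul_sum]
      refine Finset.sum_le_sum fun i _ ↦ ?_
      nlinarith [sq_nonneg (q i x - q i y + (q i z - q i y))]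
    have e3 : 4 * σ ≤ S x z := hcon x hx
    linarith
  have hins : P (insert z E) := by
    intro x hx y hy w e1 e2
    rcases Finset.mem_insert.1 hx with rfl | hx' <;> rcases Finset.mem_insert.1 hy with rfl | hy'
    · rfl
    · exact (hdisj y hy' w e2 e1).elim
    · exact (hdisj x hx' w e1 e2).elim
    · exact hE x hx' y hy' w e1 e2
  have := le_csSup (s := {m | ∃ E, P E ∧ E.card = m})
    ⟨2 * k, by rintro _ ⟨E, hE, rfl⟩; exact hPcard E hE⟩ ⟨insert z E, hins, rfl⟩
  rw [← hmax, Finset.card_insert_of_notMem hzE] at this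
  omega

end Separated

end ColouredEntropy

/-! ### The lower bound for `ht`. -/

namespace ColouredEntropy

variable {X : Type*} [TopologicalSpace X] [CompactSpace X]

theorem minSubcover_le_of_isCPSystem (T : X ≃ₜ X) {𝒰 : Set (Set X)} [Fintype 𝒰] [Nonempty 𝒰]
    (hcov : ⋃₀ 𝒰 = univ) {q : 𝒰 → C(X, ℝ)} (hq0 : ∀ U x, 0 ≤ q U x)
    (hq1 : ∀ x, ∑ U, q U x = 1) (hq2 : ∀ U x, q U x ≠ 0 → x ∈ (U : Set X)) {𝓕 : Set C(X, ℂ)}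
    (h1 : 1 ∈ 𝓕) (h2 : ∀ U, complexify (q U) ∈ 𝓕) (h3 : ∀ U, complexify (q U * q U) ∈ 𝓕)
    {θ s ε : ℝ} (hθ : 0 < θ) (hs0 : 0 < s) (hs1 : s ≤ 1)
    (hε : ε * (1 + 16 * Fintype.card 𝒰 ^ 3 / θ) ≤ 1 / 2) {n : ℕ} (hn : 0 < n)
    {F : FinDimCStarAlgebra} {ψ : C(X, ℂ) →CP F} {φ : F →CP C(X, ℂ)}
    (h : IsCPSystem (orbit (inducedEnd T) 𝓕 n) ε F ψ φ) :
    ∃ M : ℕ, minSubcover (dynCover T 𝒰 n) ≤ M ∧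
      (M : ℝ) ≤ 2 * F.rank * Real.exp ((-θ * Real.log s + Fintype.card 𝒰 * s) * n) := by
  obtain ⟨ν, hν0, hν1, hν2⟩ := h.exists_functionals
  set p : ℝ := (Fintype.card 𝒰 : ℝ) with hp
  have hp0 : 0 < p := by simpa [hp] using Fintype.card_pos (α := 𝒰)
  have hn0 : (0 : ℝ) < n := by exact_mod_cast hn
  have hqle : ∀ U x, q U x ≤ 1 := fun U x ↦ by
    rw [← hq1 x]
    exact Finset.single_le_sum (f := fun U ↦ q U x) (fun V _ ↦ hq0 V x) (Finset.mem_univ U)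
  -- Since `4 * σ = n * θ / p ^ 2` and each bad time costs at least `1 / p ^ 2`, at most `θ * n`
  -- times are bad. As `σ` grows like the number `n * p` of functions, `n` cancels from the
  -- condition on `ε`.
  have hσ : 0 < n * (θ / (4 * p ^ 2)) := by positivity
  obtain ⟨E, hE1, hE2⟩ := exists_quadratic_net ν hν0 hν2
    (fun i : Fin n × 𝒰 ↦ translate T i.1 (q i.2)) (fun i x ↦ hq0 _ _) (fun i x ↦ hqle _ _)
    (fun x ↦ by
      have := hν1 x 1 (by rw [complexify_one]; exact one_mem_orbit T h1 hn)
      simpa using this)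
    (fun i x ↦ hν1 x _ (complexify_translate_mem_orbit T (h2 _) _))
    (fun i x ↦ hν1 x (translate T i.1 (q i.2 * q i.2))
      (complexify_translate_mem_orbit T (h3 _) _)) hσ (by
      refine le_trans (le_of_eq ?_) hε
      rw [Fintype.card_prod, Fintype.card_fin, Nat.cast_mul, ← hp]
      field_simp
      ring)
  -- Some weight is at least the average; if `z` leaves that set at time `j`, its weight there is
  -- `0` and `j` is bad.
  have hc : ∀ x, ∃ U, 1 / p ≤ q U x := by
    intro x
    by_contra! hcon
    have : ∑ U, q U x < ∑ U : 𝒰, 1 / p :=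
      Finset.sum_lt_sum_of_nonempty Finset.univ_nonempty fun U _ ↦ hcon U
    rw [hq1, Finset.sum_const, Finset.card_univ, nsmul_eq_mul, ← hp,
      mul_one_div_cancel hp0.ne'] at this
    exact lt_irrefl _ this
  choose c hc using hc
  obtain ⟨M, hM1, hM2⟩ := exists_minSubcover_le_hamming T hcov E (fun x (j : Fin n) ↦ c (T^[j] x))
    (θ := θ) hs0 hs1 fun z ↦ by
      obtain ⟨x, hx, hxz⟩ := hE2 z
      refine ⟨x, hx, Finset.univ.filter fun j : Fin n ↦
        (1 / p) ^ 2 ≤ ∑ U, (q U (T^[j] x) - q U (T^[j] z)) ^ 2, ?_, fun j hj ↦ ?_⟩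
      · rw [Fintype.sum_prod_type] at hxz
        have e1 : ((Finset.univ.filter fun j : Fin n ↦
            (1 / p) ^ 2 ≤ ∑ U, (q U (T^[j] x) - q U (T^[j] z)) ^ 2).card : ℝ) * (1 / p) ^ 2 ≤
            ∑ j : Fin n, ∑ U, (q U (T^[j] x) - q U (T^[j] z)) ^ 2 := by
          rw [← nsmul_eq_mul]
          refine le_trans (Finset.card_nsmul_le_sum _ _ _ fun j hj ↦ (Finset.mem_filter.1 hj).2) ?_
          exact Finset.sum_le_sum_of_subset_of_nonneg (Finset.subset_univ _)
            fun j _ _ ↦ Finset.sum_nonneg fun U _ ↦ sq_nonneg _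
        have e2 := (e1.trans_lt hxz).le
        rw [← le_div_iff₀ (by positivity)] at e2
        refine e2.trans_eq ?_
        field_simp
      · by_contra hz
        refine hj (Finset.mem_filter.2 ⟨Finset.mem_univ _, ?_⟩)
        have e1 : q (c (T^[j] x)) (T^[j] z) = 0 := by
          by_contra hne
          exact hz (hq2 _ _ hne)
        refine le_trans ?_ (Finset.single_le_sum
          (f := fun U ↦ (q U (T^[j] x) - q U (T^[j] z)) ^ 2) (fun U _ ↦ sq_nonneg _)
          (Finset.mem_univ (c (T^[j] x))))
        simp only [e1, sub_zero]
        exact pow_le_pow_left₀ (by positivity) (hc _) 2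
  refine ⟨M, hM1, hM2.trans ?_⟩
  gcongr
  exact_mod_cast hE1

theorem topEntropy_le_ht [NormalSpace X] [Nonempty X] (T : X ≃ₜ X) :
    topEntropy T ≤ ht (inducedEnd T) := by
  refine iSup_le fun 𝒰 ↦ iSup_le fun hfin ↦ iSup_le fun hcov ↦ ?_
  have := hfin.fintype
  obtain ⟨_, q, hq0, hq1, hq2⟩ := hcov.exists_partitionOfUnity
  have key : ∀ η : ℝ, 0 < η →
      (growth fun n ↦ minSubcover (dynCover T 𝒰 n)) ≤ ht (inducedEnd T) + η := by
    intro η hη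
    have hp0 : (0 : ℝ) < Fintype.card 𝒰 := by exact_mod_cast Fintype.card_pos (α := 𝒰)
    set p : ℝ := (Fintype.card 𝒰 : ℝ) with hp
    -- The choices are made in the order `s`, `θ`, `ε`, each depending on the previous ones and none
    -- on `n`; `s` and `θ` each use half of `η`.
    obtain ⟨s, hs0, hs1, hs2⟩ : ∃ s : ℝ, 0 < s ∧ s ≤ 1 ∧ p * s ≤ η / 2 := by
      refine ⟨min 1 (η / (2 * p)), by positivity, min_le_left _ _, ?_⟩
      calc p * min 1 (η / (2 * p)) ≤ p * (η / (2 * p)) := by gcongr; exact min_le_right _ _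
        _ = η / 2 := by field_simp
    have hlog : Real.log s ≤ 0 := Real.log_nonpos hs0.le hs1
    obtain ⟨θ, hθ0, hθ1⟩ : ∃ θ : ℝ, 0 < θ ∧ -θ * Real.log s ≤ η / 2 := by
      have h0 : 0 < 1 - Real.log s := by linarith
      refine ⟨η / (2 * (1 - Real.log s)), by positivity, ?_⟩
      calc -(η / (2 * (1 - Real.log s))) * Real.log s
          = η / (2 * (1 - Real.log s)) * (-Real.log s) := by ring
        _ ≤ η / (2 * (1 - Real.log s)) * (1 - Real.log s) := by gcongr; linarith
        _ = η / 2 := by field_simp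
    have hD : 0 < 1 + 16 * p ^ 3 / θ := by positivity
    let ε : ℝ := 1 / (2 * (1 + 16 * p ^ 3 / θ))
    have hε : ε * (1 + 16 * p ^ 3 / θ) ≤ 1 / 2 := by
      refine le_of_eq ?_
      simp only [ε]
      field_simp
    let 𝓕 : Finset C(X, ℂ) := (((finite_range fun U ↦ complexify (q U)).union
      (finite_range fun U ↦ complexify (q U * q U))).insert 1).toFinset
    refine le_trans (growth_le_growth_add (v := fun n ↦ rcp (orbit (inducedEnd T) 𝓕 n) ε)
      (D := 2) (η := η) two_pos ?_) ?_
    · filter_upwards [eventually_gt_atTop 0] with n hn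
      rcases eq_or_ne (rcp (orbit (inducedEnd T) 𝓕 n) ε) ⊤ with htop | htop
      · rw [htop, ENat.toENNReal_top, ENNReal.mul_top]
        · exact le_top
        · exact (ENNReal.ofReal_pos.2 (by positivity)).ne'
      · have hne : {k : ℕ∞ | ∃ F ψ φ, IsCPSystem (orbit (inducedEnd T) (𝓕 : Set C(X, ℂ)) n) ε F ψ φ ∧
            k = (F.rank : ℕ∞)}.Nonempty := by
          by_contra hemp
          rw [Set.not_nonempty_iff_eq_empty] at hemp
          exact htop (by rw [rcp, hemp, sInf_empty])
        obtain ⟨F, ψ, φ, hsys, hrank⟩ := csInf_mem hne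
        have hrank' : rcp (orbit (inducedEnd T) 𝓕 n) ε = F.rank := hrank
        obtain ⟨M, hM1, hM2⟩ := minSubcover_le_of_isCPSystem T hcov.2 hq0 hq1 hq2
          (𝓕 := (𝓕 : Set C(X, ℂ))) (by simp [𝓕]) (fun U ↦ by simp [𝓕]) (fun U ↦ by simp [𝓕])
          hθ0 hs0 hs1 hε hn hsys
        rw [hrank', ENat.toENNReal_coe]
        calc ((minSubcover (dynCover T 𝒰 n) : ℕ∞) : ℝ≥0∞) ≤ ((M : ℕ∞) : ℝ≥0∞) :=
              ENat.toENNReal_le.2 hM1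
          _ = ENNReal.ofReal M := by rw [ENat.toENNReal_coe, ENNReal.ofReal_natCast]
          _ ≤ ENNReal.ofReal (2 * Real.exp (η * n) * F.rank) := by
              refine ENNReal.ofReal_le_ofReal (hM2.trans ?_)
              rw [mul_right_comm]
              gcongr
              linarith
          _ = _ := by rw [ENNReal.ofReal_mul (by positivity), ENNReal.ofReal_natCast]
    · gcongr
      exact le_iSup_of_le 𝓕 (le_iSup_of_le ε (le_iSup_of_le (by positivity : 0 < ε) le_rfl))
  refine EReal.le_of_forall_lt_iff_le.1 fun z hz ↦ ?_
  rcases eq_or_ne (ht (inducedEnd T)) ⊥ with hbot | hbot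
  · refine (key 1 one_pos).trans ?_
    rw [hbot, EReal.bot_add]
    exact bot_le
  · have htop : ht (inducedEnd T) ≠ ⊤ := (hz.trans_le le_top).ne
    lift ht (inducedEnd T) to ℝ using ⟨htop, hbot⟩ with a
    have hlt : a < z := by exact_mod_cast hz
    refine (key (z - a) (sub_pos.2 hlt)).trans ?_
    rw [← EReal.coe_add]
    simp

end ColouredEntropy

/-! ### Forgetting structure, and weighted sums as completely positive maps. -/

namespace ColouredEntropy

theorem cstarMatrix_sum_apply {ι m n A : Type*} [AddCommMonoid A] (s : Finset ι)
    (M : ι → CStarMatrix m n A) (a : m) (b : n) : (∑ i ∈ s, M i) a b = ∑ i ∈ s, M i a b := by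
  classical
  induction s using Finset.induction_on with
  | empty => simp
  | insert i s hi ih => rw [Finset.sum_insert hi, Finset.sum_insert hi, CStarMatrix.add_apply, ih]

/-- The projection of a direct sum onto a summand. -/
noncomputable def summandProj {k : ℕ} (F : Fin k → FinDimCStarAlgebra) (i : Fin k) :
    FinDimCStarAlgebra.directSum F →⋆ₐ[ℂ] F i where
  toFun x := x i
  map_one' := rfl
  map_mul' _ _ := rfl
  map_zero' := rfl
  map_add' _ _ := rfl
  commutes' _ := rfl
  map_star' _ := rfl

theorem entropyOfRank_mono {A : Type*} [NonUnitalCStarAlgebra A] {r s : Set A → ℝ → ℕ∞}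
    (h : ∀ 𝓕 ε, r 𝓕 ε ≤ s 𝓕 ε) (α : A →⋆ₙₐ[ℂ] A) : entropyOfRank r α ≤ entropyOfRank s α :=
  iSup_mono fun _ ↦ iSup_mono fun _ ↦ iSup_mono fun _ ↦
    growth_mono (Eventually.of_forall fun _ ↦ h _ _)

section SumMap

variable {A : Type*} [NonUnitalCStarAlgebra A] [PartialOrder A] [StarOrderedRing A]

/-- The sum map of completely positive maps on the summands is completely positive. -/
noncomputable def sumMapCP {d : ℕ} {F : Fin (d + 1) → FinDimCStarAlgebra} (φ : ∀ i, F i →CP A) :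
    FinDimCStarAlgebra.directSum F →CP A where
  toFun := sumMap φ
  map_add' x y := by
    simp only [sumMap, ← Finset.sum_add_distrib, ← map_add]
    rfl
  map_smul' c x := by
    simp only [sumMap, Finset.smul_sum, ← map_smul, RingHom.id_apply]
    rfl
  map_cstarMatrix_nonneg' k M hM := by
    have h : ∀ i, 0 ≤ (M.map (summandProj F i)).map (φ i) := fun i ↦
      (φ i).map_cstarMatrix_nonneg' k _
        (CompletelyPositiveMapClass.map_cstarMatrix_nonneg' (summandProj F i) k M hM)
    refine (Finset.sum_nonneg (s := Finset.univ) fun i _ ↦ h i).trans_eq ?_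
    ext a b
    rw [cstarMatrix_sum_apply]
    rfl

/-- Contractivity of the sum map is what turns a decomposable system into a completely positive one.
-/
theorem rcp_le_rdr (d : ℕ) (𝓕 : Set A) (ε : ℝ) : rcp 𝓕 ε ≤ rdr d 𝓕 ε := by
  refine le_sInf ?_
  rintro _ ⟨F, ψ, φ, ⟨⟨h1, -, h3⟩, h4⟩, rfl⟩
  exact sInf_le ⟨FinDimCStarAlgebra.directSum F, ψ, sumMapCP φ, ⟨h1, h4, h3⟩, rfl⟩

theorem rnuc_le_rdr (d : ℕ) (𝓕 : Set A) (ε : ℝ) : rnuc d 𝓕 ε ≤ rdr d 𝓕 ε := by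
  refine le_sInf ?_
  rintro _ ⟨F, ψ, φ, h, rfl⟩
  exact sInf_le ⟨F, ψ, φ, h.1, rfl⟩

theorem DecRankLE.nucDimLE {d : ℕ} (h : DecRankLE A d) : NucDimLE A d := fun 𝓕 ε hε ↦ by
  obtain ⟨F, ψ, φ, h⟩ := h 𝓕 ε hε
  exact ⟨F, ψ, φ, h.1⟩

end SumMap

section Upper

/-- The finite-dimensional C⋆-algebra of functions on a finite set. -/
noncomputable def functionAlgebra (ι : Type) [Fintype ι] : FinDimCStarAlgebra where
  carrier := ι → ℂ

variable {X : Type*} [TopologicalSpace X]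

/-- The homomorphism sending a function on a finite set to the constant function with its value at
a given point. -/
noncomputable def constantAt (X : Type*) [TopologicalSpace X] {ι : Type} [Fintype ι] (l : ι) :
    functionAlgebra ι →⋆ₐ[ℂ] C(X, ℂ) where
  toFun (v : ι → ℂ) := ContinuousMap.const X (v l)
  map_one' := rfl
  map_mul' _ _ := rfl
  map_zero' := rfl
  map_add' _ _ := rfl
  commutes' _ := rfl
  map_star' _ := rfl

variable [CompactSpace X]

/-- The completely positive map on a finite-dimensional commutative C⋆-algebra defined by a
family of positive functions. -/
noncomputable def weightedSum {ι : Type} [Fintype ι] (h : ι → C(X, ℝ)) (h0 : ∀ i x, 0 ≤ h i x) :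
    functionAlgebra ι →CP C(X, ℂ) where
  toFun v := ∑ l, complexify (h l) * constantAt X l v
  map_add' v w := by simp [mul_add, Finset.sum_add_distrib]
  map_smul' c v := by simp [Finset.smul_sum]
  map_cstarMatrix_nonneg' k M hM := by
    classical
    -- On matrices, multiplication by `h l` is conjugation by the diagonal matrix with entries `√(h
    -- l)`.
    let s : ι → C(X, ℂ) := fun l ↦ complexify ⟨fun x ↦ √(h l x), by fun_prop⟩
    have hs : ∀ l, s l * star (s l) = complexify (h l) := fun l ↦ by
      ext x
      simp only [s, ContinuousMap.mul_apply, ContinuousMap.star_apply, complexify_apply,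
        ContinuousMap.coe_mk, RCLike.star_def, Complex.conj_ofReal]
      rw [← Complex.ofReal_mul, Real.mul_self_sqrt (h0 l x)]
    let D : ι → CStarMatrix (Fin k) (Fin k) C(X, ℂ) := fun l ↦
      CStarMatrix.ofMatrix (Matrix.diagonal fun _ ↦ s l)
    have hpos : ∀ l, 0 ≤ D l * M.map (constantAt X l) * star (D l) := fun l ↦
      star_right_conjugate_nonneg
        (CompletelyPositiveMapClass.map_cstarMatrix_nonneg' (constantAt X l) k M hM) _
    refine (Finset.sum_nonneg (s := Finset.univ) fun l _ ↦ hpos l).trans_eq ?_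
    ext a b : 1
    rw [cstarMatrix_sum_apply, CStarMatrix.map_apply]
    change _ = ∑ l, complexify (h l) * constantAt X l (M a b)
    refine Finset.sum_congr rfl fun l _ ↦ ?_
    rw [← hs]
    simp only [CStarMatrix.mul_apply, CStarMatrix.star_apply, D, CStarMatrix.ofMatrix_apply,
      CStarMatrix.map_apply, Matrix.diagonal_apply]
    rw [Finset.sum_eq_single b (fun c _ hc ↦ by simp [hc.symm]) (by simp)]
    simp
    ring

theorem weightedSum_apply {ι : Type} [Fintype ι] (h : ι → C(X, ℝ)) (h0 : ∀ i x, 0 ≤ h i x)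
    (v : ι → ℂ) (x : X) :
    weightedSum h h0 (v : functionAlgebra ι) x = ∑ l, (h l x : ℂ) * v l := by
  change (∑ l, complexify (h l) * constantAt X l v) x = _
  rw [ContinuousMap.sum_apply]
  rfl

end Upper

end ColouredEntropy

/-! ### Decomposable systems from coloured covers. -/

namespace ColouredEntropy

section Construction

variable {X : Type*} [TopologicalSpace X] [CompactSpace X]

/-- The restriction of functions to finitely many points, sorted by colours. -/
noncomputable def evalAt {d K : ℕ} (κ : Fin K → Fin (d + 1)) (y : Fin K → X) :
    C(X, ℂ) →⋆ₐ[ℂ] FinDimCStarAlgebra.directSum fun i ↦ functionAlgebra {l // κ l = i} where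
  toFun f := fun _ (l : Subtype _) ↦ f (y l)
  map_one' := rfl
  map_mul' _ _ := rfl
  map_zero' := rfl
  map_add' _ _ := rfl
  commutes' _ := rfl
  map_star' _ := rfl

theorem rank_directSum_functionAlgebra_le {d K : ℕ} (κ : Fin K → Fin (d + 1)) :
    (FinDimCStarAlgebra.directSum fun i ↦ functionAlgebra {l // κ l = i}).rank ≤ K := by
  refine (FinDimCStarAlgebra.rank_le_finrank _).trans_eq ?_
  change Module.finrank ℂ (∀ i, {l // κ l = i} → ℂ) = K
  rw [Module.finrank_pi_fintype]
  simp_rw [Module.finrank_fintype_fun_eq_card]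
  rw [← Fintype.card_sigma, Fintype.card_congr (Equiv.sigmaFiberEquiv κ), Fintype.card_fin]

/-- A coloured open cover on whose members the functions in `𝓖` vary by at most `ε` gives rise to
a contractive decomposable system for `𝓖`. -/
theorem exists_isContractiveDecomposable [NormalSpace X] [Nonempty X] {d K : ℕ}
    {v : Fin K → Set X} (κ : Fin K → Fin (d + 1)) (ho : ∀ l, IsOpen (v l)) (hc : ∀ x, ∃ l, x ∈ v l)
    (hdis : ∀ l m, l ≠ m → κ l = κ m → Disjoint (v l) (v m)) {𝓖 : Set C(X, ℂ)} {ε : ℝ}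
    (hε : 0 ≤ ε) (hvar : ∀ a ∈ 𝓖, ∀ l, ∀ x ∈ v l, ∀ y ∈ v l, ‖a y - a x‖ ≤ ε) :
    ∃ (F : Fin (d + 1) → FinDimCStarAlgebra) (ψ : C(X, ℂ) →CP FinDimCStarAlgebra.directSum F)
      (φ : ∀ i, F i →CP C(X, ℂ)), IsContractiveDecomposable d 𝓖 ε F ψ φ ∧
        (FinDimCStarAlgebra.directSum F).rank ≤ K := by
  obtain ⟨h, h0, h1, hs⟩ := exists_partitionOfUnity ho hc
  -- For empty `v l` any sample point will do, because the weight `h l` is then zero.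
  have hy : ∀ l, ∃ y, (v l).Nonempty → y ∈ v l := fun l ↦ by
    by_cases hl : (v l).Nonempty
    · exact ⟨hl.choose, fun _ ↦ hl.choose_spec⟩
    · exact ⟨Classical.arbitrary X, fun h ↦ (hl h).elim⟩
  choose y hy using hy
  let φ : ∀ i, functionAlgebra {l // κ l = i} →CP C(X, ℂ) := fun i ↦
    weightedSum (fun l ↦ h l) fun l ↦ h0 l
  have hφ : ∀ i (w : {l // κ l = i} → ℂ) x,
      φ i (w : functionAlgebra {l // κ l = i}) x = ∑ l : {l // κ l = i}, (h l x : ℂ) * w l :=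
    fun i w x ↦ weightedSum_apply _ _ w x
  have hsum : ∀ (w : ∀ i, {l // κ l = i} → ℂ) x,
      sumMap φ (w : FinDimCStarAlgebra.directSum fun i ↦ functionAlgebra {l // κ l = i}) x =
        ∑ l, (h l x : ℂ) * w (κ l) ⟨l, rfl⟩ := by
    intro w x
    have : sumMap φ (w : FinDimCStarAlgebra.directSum fun i ↦ functionAlgebra {l // κ l = i}) x =
        ∑ i, ∑ l : {l // κ l = i}, (h l x : ℂ) * w i l := by
      simp only [sumMap, ContinuousMap.sum_apply]
      exact Finset.sum_congr rfl fun i _ ↦ hφ i (w i) x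
    rw [this, ← Fintype.sum_fiberwise κ]
    refine Finset.sum_congr rfl fun i _ ↦ Finset.sum_congr rfl fun l _ ↦ ?_
    obtain ⟨l, rfl⟩ := l
    rfl
  refine ⟨_, (evalAt κ y : C(X, ℂ) →CP _), φ, ⟨⟨?_, fun i ↦ ⟨?_, ?_⟩, ?_⟩, ?_⟩,
    rank_directSum_functionAlgebra_le κ⟩
  · intro f
    change ‖(fun i (l : {l // κ l = i}) ↦ f (y l) : ∀ i, {l // κ l = i} → ℂ)‖ ≤ ‖f‖
    refine (pi_norm_le_iff_of_nonneg (norm_nonneg _)).2 fun i ↦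
      (pi_norm_le_iff_of_nonneg (norm_nonneg _)).2 fun l ↦ ContinuousMap.norm_coe_le_norm f _
  · intro w
    refine (ContinuousMap.norm_le _ (norm_nonneg _)).2 fun x ↦ ?_
    rw [hφ i w x]
    refine (norm_sum_le _ _).trans ?_
    calc ∑ l : {l // κ l = i}, ‖(h l x : ℂ) * w l‖
        ≤ ∑ l : {l // κ l = i}, h l x * ‖w‖ := by
          refine Finset.sum_le_sum fun l _ ↦ ?_
          rw [norm_mul, Complex.norm_real, Real.norm_of_nonneg (h0 l x)]
          exact mul_le_mul_of_nonneg_left (norm_le_pi_norm (G := fun _ ↦ ℂ) w l) (h0 l x)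
      _ ≤ 1 * ‖w‖ := by
          rw [← Finset.sum_mul]
          refine mul_le_mul_of_nonneg_right ?_ (norm_nonneg _)
          rw [← h1 x, ← Fintype.sum_fiberwise κ]
          exact Finset.single_le_sum (f := fun i ↦ ∑ l : {l // κ l = i}, h l x)
            (fun j _ ↦ Finset.sum_nonneg fun l _ ↦ h0 l x) (Finset.mem_univ i)
      _ = ‖w‖ := one_mul _
  -- Cross terms vanish because sets of one colour are disjoint, diagonal terms because `a * b = 0`.
  · intro a b _ _ hab
    ext x
    rw [ContinuousMap.mul_apply, hφ i a x, hφ i b x, Finset.sum_mul_sum]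
    refine Finset.sum_eq_zero fun l _ ↦ Finset.sum_eq_zero fun m _ ↦ ?_
    by_cases hlm : l = m
    · subst hlm
      have : (a : {l // κ l = i} → ℂ) l * (b : {l // κ l = i} → ℂ) l = 0 := congr_fun hab l
      linear_combination ((h l x : ℂ) * h l x) * this
    · have hd := hdis l m (fun h ↦ hlm (Subtype.ext h)) (l.2.trans m.2.symm)
      have : h l x = 0 ∨ h m x = 0 := by
        by_contra! hne
        exact Set.disjoint_left.1 hd (hs _ _ hne.1) (hs _ _ hne.2)
      rcases this with h | h <;> simp [h]
  · intro a ha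
    refine (ContinuousMap.norm_le _ hε).2 fun x ↦ ?_
    have e1 : sumMap φ ((evalAt κ y : C(X, ℂ) →CP _) a) x = ∑ l, (h l x : ℂ) * a (y l) :=
      hsum (fun i l ↦ a (y l)) x
    have e2 : a x = ∑ l, (h l x : ℂ) * a x := by
      rw [← Finset.sum_mul, ← Complex.ofReal_sum, h1, Complex.ofReal_one, one_mul]
    rw [ContinuousMap.sub_apply, e1]
    conv_lhs => rw [e2]
    rw [← Finset.sum_sub_distrib]
    refine (norm_sum_le _ _).trans ?_
    calc ∑ l, ‖(h l x : ℂ) * a (y l) - (h l x : ℂ) * a x‖ ≤ ∑ l, h l x * ε := by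
          refine Finset.sum_le_sum fun l _ ↦ ?_
          rw [← mul_sub, norm_mul, Complex.norm_real, Real.norm_of_nonneg (h0 l x)]
          by_cases hz : h l x = 0
          · simp [hz]
          · have hx := hs l x hz
            exact mul_le_mul_of_nonneg_left (hvar a ha l x hx _ (hy l ⟨x, hx⟩)) (h0 l x)
      _ = ε := by rw [← Finset.sum_mul, h1, one_mul]
  · intro w
    refine (ContinuousMap.norm_le _ (norm_nonneg _)).2 fun x ↦ ?_
    rw [hsum w x]
    refine (norm_sum_le _ _).trans ?_
    calc ∑ l, ‖(h l x : ℂ) * (w : ∀ i, {l // κ l = i} → ℂ) (κ l) ⟨l, rfl⟩‖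
        ≤ ∑ l, h l x * ‖w‖ := by
          refine Finset.sum_le_sum fun l _ ↦ ?_
          rw [norm_mul, Complex.norm_real, Real.norm_of_nonneg (h0 l x)]
          refine mul_le_mul_of_nonneg_left ?_ (h0 l x)
          refine (norm_le_pi_norm (G := fun _ ↦ ℂ)
            ((w : ∀ i, {l // κ l = i} → ℂ) (κ l)) ⟨l, rfl⟩).trans ?_
          exact norm_le_pi_norm (G := fun i ↦ {l // κ l = i} → ℂ) w (κ l)
      _ = ‖w‖ := by rw [← Finset.sum_mul, h1, one_mul]

/-- Finitely many continuous functions on a compact space vary by at most `ε` on the members of a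
suitable finite open cover. -/
theorem exists_isOpenCover_norm_sub_le (𝓕 : Finset C(X, ℂ)) {ε : ℝ} (hε : 0 < ε) :
    ∃ 𝒰 : Set (Set X), 𝒰.Finite ∧ IsOpenCover 𝒰 ∧
      ∀ a ∈ 𝓕, ∀ U ∈ 𝒰, ∀ x ∈ U, ∀ y ∈ U, ‖a y - a x‖ ≤ ε := by
  let N : X → Set X := fun z ↦ ⋂ a ∈ 𝓕, {x | ‖a x - a z‖ < ε / 2}
  have hN : ∀ z, IsOpen (N z) := fun z ↦ isOpen_biInter_finset fun a _ ↦
    isOpen_lt (by fun_prop) continuous_const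
  have hmem : ∀ z, z ∈ N z := fun z ↦ mem_iInter₂.2 fun a _ ↦ by simpa using hε
  obtain ⟨t, ht⟩ := isCompact_univ.elim_finite_subcover N hN
    fun z _ ↦ mem_iUnion.2 ⟨z, hmem z⟩
  refine ⟨N '' t, t.finite_toSet.image N, ⟨?_, ?_⟩, ?_⟩
  · rintro _ ⟨z, -, rfl⟩
    exact hN z
  · rw [sUnion_image]
    exact univ_subset_iff.1 ht
  · rintro a ha _ ⟨z, -, rfl⟩ x hx y hy
    have e1 : ‖a x - a z‖ < ε / 2 := mem_iInter₂.1 hx a ha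
    have e2 : ‖a y - a z‖ < ε / 2 := mem_iInter₂.1 hy a ha
    rw [show a y - a x = (a y - a z) - (a x - a z) by ring]
    exact (norm_sub_le _ _).trans (by linarith)

theorem CoveringDimLE.decRankLE [NormalSpace X] [Nonempty X] {d : ℕ} (h : CoveringDimLE X d) :
    DecRankLE C(X, ℂ) d := by
  intro 𝓕 ε hε
  obtain ⟨𝒰, hfin, hcov, hvar⟩ := exists_isOpenCover_norm_sub_le 𝓕 hε
  have := hfin.fintype
  obtain ⟨W, hW1, hW2, hW3, hW4⟩ := h.exists_coloured (U := fun U : 𝒰 ↦ (U : Set X))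
    (fun U ↦ hcov.1 U U.2) (fun x ↦ by
      obtain ⟨V, hV, hx⟩ := mem_sUnion.1 (hcov.2 ▸ mem_univ x : x ∈ ⋃₀ 𝒰)
      exact ⟨⟨V, hV⟩, hx⟩)
  let e := (Fintype.equivFin (Fin (d + 1) × 𝒰)).symm
  obtain ⟨F, ψ, φ, hsys, -⟩ := exists_isContractiveDecomposable
    (v := fun l ↦ W (e l).1 (e l).2) (fun l ↦ (e l).1) (fun l ↦ hW1 _ _) (fun x ↦ by
      obtain ⟨k, i, hx⟩ := hW2 x
      exact ⟨e.symm (k, i), by simpa using hx⟩) (fun l m hlm hκ ↦ by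
      rw [hκ]
      refine hW4 _ _ _ fun h2 ↦ hlm (e.injective (Prod.ext hκ h2))) hε.le
    (fun a ha l x hx y hy ↦ hvar a ha _ (e l).2.2 x (hW3 _ _ hx) y (hW3 _ _ hy))
  exact ⟨F, ψ, φ, hsys⟩

/-- A member of the refinement lies in some `⋂ T⁻ʲ(U j)`, so `f ∘ Tʲ` varies on it no more than `f`
does on `U j`: a cover adapted to `𝓕` serves all its iterates. -/
theorem rdr_orbit_le_minColouredRefinement [NormalSpace X] [Nonempty X] (T : X ≃ₜ X)
    {𝓕 : Set C(X, ℂ)} {ε : ℝ} (hε : 0 ≤ ε) {𝒰 : Set (Set X)}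
    (hvar : ∀ a ∈ 𝓕, ∀ U ∈ 𝒰, ∀ x ∈ U, ∀ y ∈ U, ‖a y - a x‖ ≤ ε) (n : ℕ) :
    rdr (coveringDim X).toNat (orbit (inducedEnd T) 𝓕 n) ε ≤
      minColouredRefinement (dynCover T 𝒰 n) := by
  refine le_sInf ?_
  rintro _ ⟨𝒱, ⟨⟨hV1, hV2⟩, hV3⟩, ⟨c, hc1, hc2⟩, rfl⟩
  by_cases hfin : 𝒱.Finite
  swap
  · rw [Set.encard_eq_top_iff.2 hfin]
    exact le_top
  have := hfin.fintype
  have hκ : ∀ V : 𝒱, ∃ i, (V : Set X) ∈ c i := fun V ↦ mem_iUnion.1 (hc2 ▸ V.2)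
  choose κ hκ using hκ
  let e := (Fintype.equivFin 𝒱).symm
  obtain ⟨F, ψ, φ, hsys, hrank⟩ := exists_isContractiveDecomposable
    (v := fun l ↦ (e l : Set X)) (fun l ↦ κ (e l)) (fun l ↦ hV1 _ (e l).2) (fun x ↦ by
      obtain ⟨V, hV, hx⟩ := mem_sUnion.1 (hV2 ▸ mem_univ x : x ∈ ⋃₀ 𝒱)
      exact ⟨e.symm ⟨V, hV⟩, by simpa using hx⟩) (fun l m hlm hlm' ↦
      hc1 _ (hκ (e l)) (hlm' ▸ hκ (e m)) fun h ↦ hlm (e.injective (Subtype.ext h))) hε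
    (𝓖 := orbit (inducedEnd T) 𝓕 n) (fun a ha l x hx y hy ↦ by
      obtain ⟨j, f, hf, rfl⟩ := mem_iUnion.1 ha
      obtain ⟨_, ⟨-, U, hU, rfl⟩, hsub⟩ := hV3 _ (e l).2
      rw [inducedEnd_iterate_apply, inducedEnd_iterate_apply]
      exact hvar f hf _ (hU j) _ (mem_iInter.1 (hsub hx) j) _ (mem_iInter.1 (hsub hy) j))
  refine (sInf_le ⟨F, ψ, φ, hsys, rfl⟩ : rdr _ _ _ ≤ _).trans ?_
  rw [← ENat.card_coe_set_eq, ENat.card_eq_coe_fintype_card]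
  exact_mod_cast hrank

theorem entropyOfRank_rdr_le_colouredTopEntropy [NormalSpace X] [Nonempty X] (T : X ≃ₜ X) :
    entropyOfRank (rdr (coveringDim X).toNat) (inducedEnd T) ≤ colouredTopEntropy T := by
  refine iSup_le fun 𝓕 ↦ iSup_le fun ε ↦ iSup_le fun hε ↦ ?_
  obtain ⟨𝒰, hfin, hcov, hvar⟩ := exists_isOpenCover_norm_sub_le 𝓕 hε
  exact le_iSup_of_le 𝒰 (le_iSup_of_le hfin (le_iSup_of_le hcov (growth_mono
    (Eventually.of_forall fun n ↦ rdr_orbit_le_minColouredRefinement T hε.le hvar n))))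

theorem htNuc_eq_entropyOfRank [NormalSpace X] [Nonempty X] (hX : coveringDim X < ⊤) (T : X ≃ₜ X) :
    htNuc (inducedEnd T) = entropyOfRank (rnuc (coveringDim X).toNat) (inducedEnd T) := by
  classical
  have hd := (coveringDimLE_toNat hX).decRankLE.nucDimLE
  have h : ∃ d, NucDimLE C(X, ℂ) d := ⟨_, hd⟩
  rw [htNuc, dif_pos h]
  congr 2
  exact le_antisymm (Nat.find_min' h hd) (coveringDim_toNat_le (Nat.find_spec h).coveringDimLE)

theorem htDr_eq_entropyOfRank [NormalSpace X] [Nonempty X] (hX : coveringDim X < ⊤) (T : X ≃ₜ X) :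
    htDr (inducedEnd T) = entropyOfRank (rdr (coveringDim X).toNat) (inducedEnd T) := by
  classical
  have hd := (coveringDimLE_toNat hX).decRankLE
  have h : ∃ d, DecRankLE C(X, ℂ) d := ⟨_, hd⟩
  rw [htDr, dif_pos h]
  congr 2
  exact le_antisymm (Nat.find_min' h hd)
    (coveringDim_toNat_le (Nat.find_spec h).nucDimLE.coveringDimLE)

end Construction

end ColouredEntropy

/-! ### Equality of the five entropies. -/

open ColouredEntropy
theorem theorem4p4 {X : Type*} [MetricSpace X] [CompactSpace X] [Nonempty X]
    (hX : coveringDim X < ⊤) (T : X ≃ₜ X) :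
    (∀ 𝒰 : Set (Set X), 𝒰.Finite → IsOpenCover 𝒰 →
      HasGrowthLimit (fun n ↦ minSubcover (dynCover T 𝒰 n)) ∧
      HasGrowthLimit (fun n ↦ minColouredRefinement (dynCover T 𝒰 n))) ∧
    topEntropy T = ht (inducedAut T : C(X, ℂ) →⋆ₙₐ[ℂ] C(X, ℂ)) ∧
    ht (inducedAut T : C(X, ℂ) →⋆ₙₐ[ℂ] C(X, ℂ)) =
      htNuc (inducedAut T : C(X, ℂ) →⋆ₙₐ[ℂ] C(X, ℂ)) ∧
    htNuc (inducedAut T : C(X, ℂ) →⋆ₙₐ[ℂ] C(X, ℂ)) =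
      htDr (inducedAut T : C(X, ℂ) →⋆ₙₐ[ℂ] C(X, ℂ)) ∧
    htDr (inducedAut T : C(X, ℂ) →⋆ₙₐ[ℂ] C(X, ℂ)) = colouredTopEntropy T := by
  have hc := colouredTopEntropy_eq_topEntropy hX T
  have hup : htDr (inducedEnd T) ≤ topEntropy T := by
    rw [htDr_eq_entropyOfRank hX, ← hc]
    exact entropyOfRank_rdr_le_colouredTopEntropy T
  have hht : ht (inducedEnd T) ≤ htDr (inducedEnd T) := by
    rw [htDr_eq_entropyOfRank hX]
    exact entropyOfRank_mono (fun 𝓕 ε ↦ rcp_le_rdr _ 𝓕 ε) _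
  have hnuc : htNuc (inducedEnd T) ≤ htDr (inducedEnd T) := by
    rw [htNuc_eq_entropyOfRank hX, htDr_eq_entropyOfRank hX]
    exact entropyOfRank_mono (fun 𝓕 ε ↦ rnuc_le_rdr _ 𝓕 ε) _
  have hlow1 := topEntropy_le_ht T
  have hlow2 : topEntropy T ≤ htNuc (inducedEnd T) := by
    rw [htNuc_eq_entropyOfRank hX]
    exact topEntropy_le_entropyOfRank_rnuc T _
  have e1 := le_antisymm hlow1 (hht.trans hup)
  have e2 := le_antisymm hlow2 (hnuc.trans hup)
  have e3 := le_antisymm (hlow2.trans hnuc) hup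
  exact ⟨fun 𝒰 hfin hcov ↦ ⟨hasGrowthLimit_minSubcover T hfin hcov,
    (hasGrowthLimit_minColouredRefinement hX T hfin hcov).1⟩, e1, e1.symm.trans e2,
    e2.symm.trans e3, e3.symm.trans hc.symm⟩
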